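/- Fix a prime $p$. For a $p$-Boolean algebra $R$ (an $\mathbb{F}_p$-algebra with $a^p=a$ for all $a\in R$) the ring $W(R)$ of $p$-typical Witt vectors carries the $\delta$-structure whose Frobenius lift is the Witt vector Frobenius. A \emph{Stone $\delta$-ring} is a $\delta$-ring isomorphic to some such $W(R)$; it is automatically $p$-adically complete and perfect. Call a Stone $\delta$-ring $A$ \emph{countably presented} either in the algebraic sense, if $A$ is a countably presented $\mathbb{Z}_p$-algebra, or in the $p$-complete sense, if $A/p$ is a countably presented $\mathbb{F}_p$-algebra. Fix one of these two senses; everything below holds for each of them. Let $\mathrm{TD}^{\delta,\wedge}$ be the opposite of the category of countably presented Stone $\delta$-rings and $\delta$-ring homomorphisms. Its coverings are the finite families given by $\delta$-ring homomorphisms $A\to B_1,\dots,A\to B_n$ ($n\ge 0$) for which $B=\prod_i B_i$ is $p$-completely faithfully flat over $A$, i.e. $B\otimes_A^{L}A/p$ is concentrated in degree $0$ and $A/p\to B/p$ is faithfully flat. Let $\mathrm{TDStk}^{\delta,\wedge}$ be the category of sheaves of sets on $\mathrm{TD}^{\delta,\wedge}$ for the topology generated by these coverings. Let $\mathrm{ProFin}^{\mathrm{light}}$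 be the category of second countable profinite sets, with coverings the finite jointly surjective families, and let $\mathrm{Cond}(\mathrm{Set})^{\mathrm{light}}$ be its category of sheaves of sets. Let $$u:\mathrm{TD}^{\delta,\wedge}\to\mathrm{ProFin}^{\mathrm{light}},\qquad u(A)=\mathrm{Hom}_{\delta}(A,\mathbb{Z}_p),$$ where $\mathrm{Hom}_\delta(A,\mathbb{Z}_p)$ is the set of $\delta$-ring homomorphisms with the topology of pointwise convergence. Then: 1. The map $u(A)\to\mathrm{Spec}(A/p)$, $f\mapsto\ker(\bar f: A/p\to\mathbb{F}_p)$, is a homeomorphism, natural in $A$. 2. $\mathrm{TD}^{\delta,\wedge}$ has fibre products, its coverings form a pretopology, and $u$ is continuous: it sends coverings to coverings, and for every covering $\{U_i\to U\}$ and every map $V\to U$ it preserves the fibre products $V\times_U U_i$. 3. $u$ induces a morphism of topoi $\psi:\mathrm{Cond}(\mathrm{Set})^{\mathrm{light}}\to\mathrm{TDStk}^{\delta,\wedge}$: the formula $(\psi_*X)(A)=X(u(A))$ defines a functor $\psi_*:\mathrm{Cond}(\mathrm{Set})^{\mathrm{light}}\to\mathrm{TDStk}^{\delta,\wedge}$;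 for every presheaf of sets $F$ on $\mathrm{TD}^{\delta,\wedge}$ the presheaf $(u_pF)(S)=\mathrm{colim}_{(A,\,S\to u(A))}F(A)$ (the pointwise left Kan extension of $F$ along $u$) exists; the functor $\psi^*$ sending a sheaf $F$ to the sheaf associated with $u_pF$ is left adjoint to $\psi_*$; and $\psi^*$ preserves finite limits. -/

import Mathlib

open CategoryTheory CategoryTheory.Limits Opposite

noncomputable section

namespace StoneDelta

/-! ### Delta-rings -/

/-- A `δ`-ring structure on a commutative ring `A`, relative to the prime `p`. In the additivity
axiom the natural number `p.choose i / p` is the exact quotient, so that the sum subtracted is the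
integral polynomial `((x + y) ^ p - x ^ p - y ^ p) / p`. -/
class DeltaRing (p : ℕ) (A : Type) [CommRing A] where
  /-- The operation `δ`. -/
  δ : A → A
  delta_one : δ 1 = 0
  delta_mul : ∀ x y : A, δ (x * y) = x ^ p * δ y + δ x * y ^ p + (p : A) * δ x * δ y
  delta_add : ∀ x y : A, δ (x + y) =
    δ x + δ y - ∑ i ∈ Finset.Ioo 0 p, ((p.choose i / p : ℕ) : A) * x ^ i * y ^ (p - i)

/-- Homomorphisms of `δ`-rings. Between `p`-adically complete `δ`-rings they are automatically
`p`-adically continuous, since every ring homomorphism maps `p ^ n A` into `p ^ n B`. -/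
@[ext]
structure DeltaHom (p : ℕ) (A B : Type) [CommRing A] [CommRing B] [DeltaRing p A]
    [DeltaRing p B] where
  /-- The underlying ring homomorphism. -/
  toRingHom : A →+* B
  map_delta : ∀ x : A, toRingHom (DeltaRing.δ p x) = DeltaRing.δ p (toRingHom x)

/-- The category of `δ`-rings. -/
structure DeltaRingCat (p : ℕ) where
  /-- The underlying type. -/
  carrier : Type
  [commRing : CommRing carrier]
  [deltaRing : DeltaRing p carrier]

attribute [instance] DeltaRingCat.commRing DeltaRingCat.deltaRing

instance (p : ℕ) : CoeSort (DeltaRingCat p) Type := ⟨DeltaRingCat.carrier⟩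

instance (p : ℕ) : Category (DeltaRingCat p) where
  Hom A B := DeltaHom p A B
  id A := ⟨RingHom.id A, fun _ => rfl⟩
  comp f g := ⟨g.toRingHom.comp f.toRingHom, fun x => by simp [f.map_delta, g.map_delta]⟩

theorem add_pow_prime {A : Type} [CommRing A] (p : ℕ) [hp : Fact p.Prime] (x y : A) :
    (x + y) ^ p = x ^ p + y ^ p +
      p * ∑ i ∈ Finset.Ioo 0 p, ((p.choose i / p : ℕ) : A) * x ^ i * y ^ (p - i) := by
  have h0 : 0 < p := hp.out.pos
  rw [add_pow, Finset.sum_range_succ, Finset.range_eq_Ico,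
    Finset.sum_eq_sum_Ico_succ_bot h0, Finset.mul_sum]
  have : Finset.Ico (0 + 1) p = Finset.Ioo 0 p := by ext i; simp; omega
  rw [this]
  have h2 : ∀ i ∈ Finset.Ioo 0 p, x ^ i * y ^ (p - i) * (p.choose i : A) =
      p * (((p.choose i / p : ℕ) : A) * x ^ i * y ^ (p - i)) := by
    intro i hi
    rw [Finset.mem_Ioo] at hi
    have hd : p ∣ p.choose i := hp.out.dvd_choose_self hi.1.ne' hi.2
    have : (p.choose i : A) = p * ((p.choose i / p : ℕ) : A) := by
      rw [← Nat.cast_mul, Nat.mul_div_cancel' hd]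
    rw [this]; ring
  rw [Finset.sum_congr rfl h2]
  simp
  ring

/-- On a `p`-torsion-free ring, a lift `φ` of the Frobenius endomorphism modulo `p` determines
the `δ`-ring structure with `φ x = x ^ p + p * δ x`. -/
@[reducible]
def DeltaRing.ofFrobeniusLift {A : Type} [CommRing A] (p : ℕ) [Fact p.Prime] (φ : A →+* A)
    (tf : ∀ x : A, (p : A) * x = 0 → x = 0) (h : ∀ x : A, ∃ y : A, φ x = x ^ p + p * y) :
    DeltaRing p A where
  δ x := (h x).choose
  delta_one := by
    apply tf
    have h1 := (h 1).choose_spec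
    generalize (h 1).choose = a at *
    rw [map_one, one_pow] at h1
    linear_combination -h1
  delta_mul x y := by
    rw [← sub_eq_zero]
    apply tf
    have h1 := (h x).choose_spec
    have h2 := (h y).choose_spec
    have h3 := (h (x * y)).choose_spec
    generalize (h x).choose = a at *
    generalize (h y).choose = b at *
    generalize (h (x * y)).choose = c at *
    rw [map_mul, mul_pow, h1, h2] at h3
    linear_combination -h3
  delta_add x y := by
    rw [← sub_eq_zero]
    apply tf
    have h1 := (h x).choose_spec
    have h2 := (h y).choose_spec
    have h3 := (h (x + y)).choose_spec
    generalize (h x).choose = a at *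
    generalize (h y).choose = b at *
    generalize (h (x + y)).choose = c at *
    rw [map_add, add_pow_prime, h1, h2] at h3
    linear_combination -h3

/-! ### The delta-ring of p-adic integers -/

theorem padicInt_frobenius (p : ℕ) [hp : Fact p.Prime] (x : ℤ_[p]) :
    ∃ y : ℤ_[p], RingHom.id ℤ_[p] x = x ^ p + p * y := by
  have : x - x ^ p ∈ RingHom.ker (PadicInt.toZMod (p := p)) := by
    rw [RingHom.mem_ker, map_sub, map_pow, ZMod.pow_card, sub_self]
  rw [PadicInt.ker_toZMod, PadicInt.maximalIdeal_eq_span_p, Ideal.mem_span_singleton] at this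
  obtain ⟨y, hy⟩ := this
  exact ⟨y, by rw [← hy]; simp⟩

/-- The `δ`-ring `ℤ_p`, whose Frobenius lift is the identity. -/
instance (p : ℕ) [hp : Fact p.Prime] : DeltaRing p ℤ_[p] :=
  DeltaRing.ofFrobeniusLift p (RingHom.id _)
    (fun x hx => (mul_eq_zero.1 hx).resolve_left (by exact_mod_cast hp.out.ne_zero))
    (padicInt_frobenius p)

theorem padicInt_delta (p : ℕ) [Fact p.Prime] (x : ℤ_[p]) :
    x = x ^ p + p * DeltaRing.δ p x :=
  (padicInt_frobenius p x).choose_spec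

/-! ### Stone delta-rings -/

/-- `p`-Boolean algebras: `𝔽_p`-algebras in which `a ^ p = a` for every `a`. -/
structure PBoolean (p : ℕ) where
  /-- The underlying type. -/
  carrier : Type
  [commRing : CommRing carrier]
  [algebra : Algebra (ZMod p) carrier]
  pow_eq : ∀ a : carrier, a ^ p = a

attribute [instance] PBoolean.commRing PBoolean.algebra

theorem PBoolean.subsingleton_or_charP {p : ℕ} [Fact p.Prime] (R : PBoolean p) :
    Subsingleton R.carrier ∨ CharP R.carrier p := by
  rcases subsingleton_or_nontrivial R.carrier with h | h
  · exact Or.inl h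
  · exact Or.inr (charP_of_injective_algebraMap (algebraMap (ZMod p) R.carrier).injective p)

theorem PBoolean.witt_subsingleton {p : ℕ} (R : PBoolean p) [Subsingleton R.carrier] :
    Subsingleton (WittVector p R.carrier) :=
  ⟨fun _ _ => WittVector.ext fun _ => Subsingleton.elim _ _⟩

theorem PBoolean.witt_frobenius_eq {p : ℕ} [Fact p.Prime] (R : PBoolean p)
    (x : WittVector p R.carrier) : WittVector.frobenius x = x := by
  rcases R.subsingleton_or_charP with h | h
  · have := R.witt_subsingleton
    exact Subsingleton.elim _ _
  · ext n
    rw [WittVector.coeff_frobenius_charP, R.pow_eq]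

theorem PBoolean.witt_torsionFree {p : ℕ} [Fact p.Prime] (R : PBoolean p)
    (x : WittVector p R.carrier) (hx : (p : WittVector p R.carrier) * x = 0) : x = 0 := by
  rw [mul_comm, ← WittVector.frobenius_verschiebung, R.witt_frobenius_eq] at hx
  ext n
  rw [← WittVector.verschiebung_coeff_succ, hx]
  simp

theorem PBoolean.witt_frobenius {p : ℕ} [hp : Fact p.Prime] (R : PBoolean p)
    (x : WittVector p R.carrier) :
    ∃ y : WittVector p R.carrier, WittVector.frobenius x = x ^ p + p * y := by
  have h : (WittVector.frobenius x - x ^ p).coeff 0 = 0 := by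
    rw [R.witt_frobenius_eq]
    change WittVector.constantCoeff (x - x ^ p) = 0
    rw [map_sub, map_pow, R.pow_eq, sub_self]
  refine ⟨(WittVector.frobenius x - x ^ p).shift 1, ?_⟩
  have h2 := WittVector.verschiebung_shift (WittVector.frobenius x - x ^ p) 0 (by
    intro i hi
    rcases Nat.lt_one_iff.1 hi
    exact h)
  have h3 : (WittVector.frobenius x - x ^ p).shift 0 = WittVector.frobenius x - x ^ p := by
    ext n
    simp [WittVector.shift]
  rw [h3] at h2
  rw [mul_comm, ← WittVector.frobenius_verschiebung, R.witt_frobenius_eq (.verschiebung _), h2]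
  ring

/-- The `δ`-ring `W(R)` of `p`-typical Witt vectors of a `p`-Boolean algebra `R`; its Frobenius
lift is the Witt vector Frobenius. -/
def PBoolean.witt {p : ℕ} [Fact p.Prime] (R : PBoolean p) : DeltaRingCat p where
  carrier := WittVector p R.carrier
  deltaRing := DeltaRing.ofFrobeniusLift p WittVector.frobenius R.witt_torsionFree
    R.witt_frobenius

/-- Stone `δ`-rings: the essential image of `W` on `p`-Boolean algebras. (Such `δ`-rings are
`p`-adically complete and perfect, and all `δ`-ring homomorphisms between them are allowed.) -/
def IsStone (p : ℕ) [Fact p.Prime] : ObjectProperty (DeltaRingCat p) :=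
  fun A => ∃ R : PBoolean p, Nonempty (A ≅ R.witt)

/-! ### Countable presentations -/

/-- The reduction `A / p`. -/
abbrev ModP (p : ℕ) (A : Type) [CommRing A] : Type := A ⧸ Ideal.span {(p : A)}

/-- `A` is countably presented as an algebra over `k`, for the `k`-algebra structure underlying
some surjection of rings `k[x₀, x₁, …] → A` with countably generated kernel. -/
def HasCountablePresentation (k A : Type) [CommRing k] [CommRing A] : Prop :=
  ∃ f : MvPolynomial ℕ k →+* A, Function.Surjective f ∧
    ∃ S : Set (MvPolynomial ℕ k), S.Countable ∧ RingHom.ker f = Ideal.span S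

/-- The two senses in which a `p`-complete ring can be countably presented over `ℤ_p`. -/
inductive PresentationSense where
  /-- as an abstract `ℤ_p`-algebra -/
  | algebraic
  /-- up to `p`-completion, that is, modulo `p` -/
  | pComplete

/-- Countably presented `δ`-rings: in the algebraic sense, `A` is a countably presented
`ℤ_p`-algebra (a `p`-complete ring has just one `ℤ_p`-algebra structure); in the `p`-complete
sense, `A / p` is a countably presented `𝔽_p`-algebra. -/
def IsCountablyPresented (p : ℕ) [Fact p.Prime] :
    PresentationSense → ObjectProperty (DeltaRingCat p)
  | .algebraic => fun A => HasCountablePresentation ℤ_[p] A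
  | .pComplete => fun A => HasCountablePresentation (ZMod p) (ModP p A)

/-- The category of countably presented Stone `δ`-rings. -/
abbrev CountableStone (p : ℕ) [Fact p.Prime] (s : PresentationSense) : Type 1 :=
  (IsStone p ⊓ IsCountablyPresented p s).FullSubcategory

/-- The category `TD`, opposite to countably presented Stone `δ`-rings. -/
abbrev TD (p : ℕ) [Fact p.Prime] (s : PresentationSense) : Type 1 := (CountableStone p s)ᵒᵖ

theorem countable_mvPolynomial (k : Type) [CommSemiring k] [Countable k] :
    Countable (MvPolynomial ℕ k) := by
  rw [← Cardinal.mk_le_aleph0_iff]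
  refine (MvPolynomial.cardinalMk_le_max).trans ?_
  simp

theorem countable_modP_of_algebraic (p : ℕ) [Fact p.Prime] (A : Type) [CommRing A]
    (h : HasCountablePresentation ℤ_[p] A) : Countable (ModP p A) := by
  obtain ⟨f, hf, -⟩ := h
  let g : MvPolynomial ℕ ℤ_[p] →+* ModP p A := (Ideal.Quotient.mk _).comp f
  have hg : Function.Surjective g := Ideal.Quotient.mk_surjective.comp hf
  let e : MvPolynomial ℕ ℕ → ModP p A := fun q => g (MvPolynomial.map (Nat.castRingHom _) q)
  have hp0 : (p : ModP p A) = 0 := by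
    rw [← map_natCast (Ideal.Quotient.mk (Ideal.span {(p : A)})), Ideal.Quotient.eq_zero_iff_mem]
    exact Ideal.mem_span_singleton_self _
  have key : ∀ q, ∃ r, e r = g q := by
    intro q
    induction q using MvPolynomial.induction_on with
    | C z =>
      obtain ⟨n, -, hn⟩ := PadicInt.existsUnique_mem_range z |>.exists
      rw [PadicInt.maximalIdeal_eq_span_p, Ideal.mem_span_singleton] at hn
      obtain ⟨w, hw⟩ := hn
      refine ⟨MvPolynomial.C n, ?_⟩
      have : z = n + p * w := by rw [← hw]; ring
      rw [this]
      simp [e, hp0]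
    | add a b ha hb =>
      obtain ⟨r, hr⟩ := ha
      obtain ⟨t, ht⟩ := hb
      exact ⟨r + t, by simp only [e, map_add] at *; rw [hr, ht]⟩
    | mul_X a i ha =>
      obtain ⟨r, hr⟩ := ha
      exact ⟨r * MvPolynomial.X i, by simp only [e, map_mul, MvPolynomial.map_X] at *; rw [hr]⟩
  have : Function.Surjective e := fun a => by
    obtain ⟨q, rfl⟩ := hg a
    exact key q
  have : Countable (MvPolynomial ℕ ℕ) := countable_mvPolynomial ℕ
  exact Function.Surjective.countable ‹Function.Surjective e›

theorem countable_modP (p : ℕ) [Fact p.Prime] (s : PresentationSense) (A : DeltaRingCat p)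
    (h : IsCountablyPresented p s A) : Countable (ModP p A) := by
  cases s with
  | algebraic => exact countable_modP_of_algebraic p A h
  | pComplete =>
    obtain ⟨f, hf, -⟩ := h
    have : Countable (MvPolynomial ℕ (ZMod p)) := countable_mvPolynomial _
    exact hf.countable

/-! ### The functor u -/

/-- The set `Hom(A, ℤ_p)` of `δ`-ring homomorphisms. -/
abbrev Points (p : ℕ) [Fact p.Prime] (A : DeltaRingCat p) : Type := DeltaHom p A ℤ_[p]

/-- `Hom(A, ℤ_p)` carries the topology of pointwise convergence. -/
instance (p : ℕ) [Fact p.Prime] (A : DeltaRingCat p) : TopologicalSpace (Points p A) :=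
  TopologicalSpace.induced (fun f (a : A) => f.toRingHom a) inferInstance

/-- Reduction `A / p → 𝔽_p` of a homomorphism `A → ℤ_p`. -/
def residue {p : ℕ} [Fact p.Prime] {A : DeltaRingCat p} (f : Points p A) :
    ModP p A →+* ZMod p :=
  Ideal.Quotient.lift _ (PadicInt.toZMod.comp f.toRingHom) fun a ha => by
    obtain ⟨b, rfl⟩ := Ideal.mem_span_singleton.1 ha
    simp

theorem residue_injective {p : ℕ} [Fact p.Prime] {A : DeltaRingCat p} (f g : Points p A)
    (h : ∀ a, residue f a = residue g a) : f = g := by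
  have h1 : ∀ n : ℕ, ∀ a : A, (p : ℤ_[p]) ^ (n + 1) ∣ f.toRingHom a - g.toRingHom a := by
    intro n
    induction n with
    | zero =>
      intro a
      have := h (Ideal.Quotient.mk _ a)
      simp only [residue, Ideal.Quotient.lift_mk, RingHom.comp_apply] at this
      rw [zero_add, pow_one, ← Ideal.mem_span_singleton, ← PadicInt.maximalIdeal_eq_span_p,
        ← PadicInt.ker_toZMod, RingHom.mem_ker, map_sub, this, sub_self]
    | succ n ih =>
      intro a
      have e : f.toRingHom a - g.toRingHom a = (f.toRingHom a ^ p - g.toRingHom a ^ p) +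
          p * (f.toRingHom (DeltaRing.δ p a) - g.toRingHom (DeltaRing.δ p a)) := by
        have h1 := padicInt_delta p (f.toRingHom a)
        have h2 := padicInt_delta p (g.toRingHom a)
        rw [f.map_delta, g.map_delta]
        linear_combination h1 - h2
      rw [e]
      refine dvd_add ?_ ?_
      · obtain ⟨c, hc⟩ := ih a
        have hf : f.toRingHom a = g.toRingHom a + p ^ (n + 1) * c := by rw [← hc]; ring
        rw [hf, add_pow_prime]
        have : g.toRingHom a ^ p + ((p : ℤ_[p]) ^ (n + 1) * c) ^ p + p * ∑ i ∈ Finset.Ioo 0 p,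
            ((p.choose i / p : ℕ) : ℤ_[p]) * g.toRingHom a ^ i *
              ((p : ℤ_[p]) ^ (n + 1) * c) ^ (p - i) - g.toRingHom a ^ p =
            ((p : ℤ_[p]) ^ (n + 1) * c) ^ p + p * ∑ i ∈ Finset.Ioo 0 p,
            ((p.choose i / p : ℕ) : ℤ_[p]) * g.toRingHom a ^ i *
              ((p : ℤ_[p]) ^ (n + 1) * c) ^ (p - i) := by ring
        rw [this]
        refine dvd_add ?_ ?_
        · rw [mul_pow, ← pow_mul]
          refine Dvd.dvd.mul_right (pow_dvd_pow _ ?_) _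
          have := (Fact.out : p.Prime).two_le
          nlinarith
        · rw [pow_succ' _ (n + 1)]
          refine mul_dvd_mul_left _ (Finset.dvd_sum fun i hi => Dvd.dvd.mul_left ?_ _)
          rw [Finset.mem_Ioo] at hi
          exact dvd_pow (Dvd.intro _ rfl) (by omega)
      · rw [pow_succ' _ (n + 1)]
        exact mul_dvd_mul_left _ (ih _)
  have h2 : ∀ a : A, f.toRingHom a = g.toRingHom a := by
    intro a
    rw [← sub_eq_zero]
    by_contra hne
    have hn := h1 (f.toRingHom a - g.toRingHom a).valuation a
    rw [← Ideal.mem_span_singleton, PadicInt.mem_span_pow_iff_le_valuation _ hne] at hn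
    omega
  exact DeltaHom.ext (RingHom.ext h2)

theorem points_isEmbedding {p : ℕ} [Fact p.Prime] (A : DeltaRingCat p) :
    Topology.IsEmbedding (fun (f : Points p A) (a : A) => f.toRingHom a) :=
  ⟨⟨rfl⟩, fun _ _ h => DeltaHom.ext (RingHom.ext (congrFun h))⟩

theorem continuous_eval {p : ℕ} [Fact p.Prime] (A : DeltaRingCat p) (a : A) :
    Continuous fun f : Points p A => f.toRingHom a :=
  (continuous_apply a).comp (points_isEmbedding A).continuous

theorem padicInt_delta_unique (p : ℕ) [hp : Fact p.Prime] (x y : ℤ_[p]) (h : x = x ^ p + p * y) :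
    y = DeltaRing.δ p x := by
  have h2 := padicInt_delta p x
  have hp0 : (p : ℤ_[p]) ≠ 0 := by exact_mod_cast hp.out.ne_zero
  apply mul_left_cancel₀ hp0
  linear_combination h2 - h

instance {p : ℕ} [Fact p.Prime] (A : DeltaRingCat p) : CompactSpace (Points p A) := by
  have hc : Topology.IsClosedEmbedding (fun (f : Points p A) (a : A) => f.toRingHom a) := by
    refine ⟨points_isEmbedding A, ?_⟩
    have : Set.range (fun (f : Points p A) (a : A) => f.toRingHom a) =
        {g : A → ℤ_[p] | g 1 = 1} ∩ ((⋂ x : A, ⋂ y : A, {g | g (x * y) = g x * g y}) ∩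
          ((⋂ x : A, ⋂ y : A, {g | g (x + y) = g x + g y}) ∩
            (⋂ x : A, {g | g x = g x ^ p + p * g (DeltaRing.δ p x)}))) := by
      ext g
      simp only [Set.mem_range, Set.mem_inter_iff, Set.mem_iInter, Set.mem_ofPred_eq]
      constructor
      · rintro ⟨f, rfl⟩
        refine ⟨map_one _, fun x y => map_mul _ _ _, fun x y => map_add _ _ _, fun x => ?_⟩
        simp only [f.map_delta]
        exact padicInt_delta p _
      · rintro ⟨h1, h2, h3, h4⟩
        have h0 : g 0 = 0 := by
          have := h3 0 0
          rw [add_zero] at this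
          exact left_eq_add.1 this
        exact ⟨⟨⟨⟨⟨g, h1⟩, h2⟩, h0, h3⟩, fun x => padicInt_delta_unique p _ _ (h4 x)⟩, rfl⟩
    rw [this]
    refine (isClosed_eq (by fun_prop) (by fun_prop)).inter
      ((isClosed_iInter fun x => isClosed_iInter fun y =>
        isClosed_eq (by fun_prop) (by fun_prop)).inter
      ((isClosed_iInter fun x => isClosed_iInter fun y =>
        isClosed_eq (by fun_prop) (by fun_prop)).inter
      (isClosed_iInter fun x => isClosed_eq (by fun_prop) (by fun_prop))))
  exact hc.compactSpace

instance {p : ℕ} [Fact p.Prime] (A : DeltaRingCat p) : T2Space (Points p A) :=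
  (points_isEmbedding A).t2Space

instance {p : ℕ} [Fact p.Prime] (A : DeltaRingCat p) : TotallyDisconnectedSpace (Points p A) := by
  exact ⟨(points_isEmbedding A).isTotallyDisconnected
    (isTotallyDisconnected_of_totallyDisconnectedSpace _)⟩

theorem continuous_residue {p : ℕ} [Fact p.Prime] (A : DeltaRingCat p) (a : ModP p A) :
    Continuous fun f : Points p A => residue f a := by
  obtain ⟨a, rfl⟩ := Ideal.Quotient.mk_surjective a
  have : Continuous (PadicInt.toZMod (p := p)) := by
    refine IsLocallyConstant.continuous ((IsLocallyConstant.iff_exists_open _).2 fun x => ?_)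
    refine ⟨Metric.ball x 1, Metric.isOpen_ball, Metric.mem_ball_self one_pos, fun y hy => ?_⟩
    rw [← sub_eq_zero, ← map_sub, ← RingHom.mem_ker, PadicInt.ker_toZMod,
      IsLocalRing.mem_maximalIdeal, PadicInt.mem_nonunits]
    rwa [Metric.mem_ball, dist_eq_norm] at hy
  exact this.comp (continuous_eval A a)

theorem points_secondCountable {p : ℕ} [Fact p.Prime] (A : DeltaRingCat p)
    [Countable (ModP p A)] : SecondCountableTopology (Points p A) := by
  have hc : Continuous fun (f : Points p A) (a : ModP p A) => residue f a :=
    continuous_pi fun a => continuous_residue A a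
  have he := (hc.isClosedEmbedding fun f g h => residue_injective f g (congrFun h)).isEmbedding
  exact he.secondCountableTopology

instance {p : ℕ} [Fact p.Prime] {s : PresentationSense} (A : CountableStone p s) :
    SecondCountableTopology (Points p A.obj) :=
  have := countable_modP p s A.obj A.property.2
  points_secondCountable A.obj

/-- Precomposition of a `δ`-ring homomorphism `B → ℤ_p` with `A → B`. -/
def precomp {p : ℕ} [Fact p.Prime] {A B : DeltaRingCat p} (g : A ⟶ B) (f : Points p B) :
    Points p A :=
  ⟨f.toRingHom.comp (DeltaHom.toRingHom g),
    fun x => by simp [f.map_delta, DeltaHom.map_delta g]⟩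

theorem continuous_precomp {p : ℕ} [Fact p.Prime] {A B : DeltaRingCat p} (g : A ⟶ B) :
    Continuous (precomp g) :=
  (points_isEmbedding A).continuous_iff.2 (continuous_pi fun _ => continuous_eval B _)

/-- The functor `u : TD ⥤ ProFin^light`, `A ↦ Hom(A, ℤ_p)`. -/
def u (p : ℕ) [Fact p.Prime] (s : PresentationSense) : TD p s ⥤ LightProfinite.{0} where
  obj A := LightProfinite.of (Points p A.unop.obj)
  map g := CompHausLike.ofHom _ ⟨precomp g.unop.hom, continuous_precomp _⟩

/-! ### The comparison with the spectrum of the reduction -/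

/-- The map `Hom(A, ℤ_p) → Spec (A / p)`, sending a homomorphism `f` to the kernel of its
reduction `A / p → 𝔽_p`. -/
def toSpec {p : ℕ} [Fact p.Prime] (A : DeltaRingCat p) (f : Points p A) :
    PrimeSpectrum (ModP p A) :=
  ⟨RingHom.ker (residue f), RingHom.ker_isPrime _⟩

/-- The reduction modulo `p` of a ring homomorphism. -/
def mapModP (p : ℕ) {A B : Type} [CommRing A] [CommRing B] (g : A →+* B) :
    ModP p A →+* ModP p B :=
  Ideal.quotientMap _ g (by
    rw [Ideal.span_singleton_le_iff_mem, Ideal.mem_comap, map_natCast]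
    exact Ideal.mem_span_singleton_self _)

/-! ### Coverings -/

/-- `p`-completely faithfully flat ring homomorphisms `A → B`: the derived tensor product of `B`
with `A / p` over `A` is concentrated in degree zero, and `A / p → B / p` is faithfully flat. -/
def IsPCompletelyFaithfullyFlat (p : ℕ) {A B : Type} [CommRing A] [CommRing B]
    (f : A →+* B) : Prop :=
  (∀ i : ℕ, IsZero (((Tor (ModuleCat.{0} A) (i + 1)).obj
    ((ModuleCat.restrictScalars f).obj (ModuleCat.of B B))).obj (ModuleCat.of A (ModP p A)))) ∧
  (mapModP p f).FaithfullyFlat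

/-- The coverings in `TD`: finite families `{A → B i}` of countably presented Stone `δ`-rings such
that `A → ∏ i, B i` is `p`-completely faithfully flat. -/
def tdCoverings (p : ℕ) [Fact p.Prime] (s : PresentationSense) : Precoverage (TD p s) where
  coverings A := {R | ∃ (n : ℕ) (B : Fin n → TD p s) (f : ∀ i, B i ⟶ A),
    R = Presieve.ofArrows B f ∧
    IsPCompletelyFaithfullyFlat p
      (RingHom.pi fun i => DeltaHom.toRingHom (f i).unop.hom :
        A.unop.obj →+* ∀ i, (B i).unop.obj)}

/-- The coverings of light profinite sets: finite jointly surjective families. -/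
def lightCoverings : Precoverage LightProfinite.{0} where
  coverings S := {R | ∃ (n : ℕ) (T : Fin n → LightProfinite.{0}) (f : ∀ i, T i ⟶ S),
    R = Presieve.ofArrows T f ∧ ∀ x : S, ∃ (i : Fin n) (y : T i), f i y = x}

/-- Totally disconnected formal `δ`-stacks: sheaves of sets on `TD` for the topology generated by
the `p`-completely faithfully flat coverings. -/
abbrev TDStk (p : ℕ) [Fact p.Prime] (s : PresentationSense) :=
  Sheaf (tdCoverings p s).toGrothendieck Type

/-- `S` makes `C` a site, in the sense of a category with covering families: `C` has fibre
products, and the coverings are those of a pretopology. -/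
def IsSite {C : Type*} [Category* C] (S : Precoverage C) : Prop :=
  ∃ (_ : HasPullbacks C) (T : Pretopology C), T.toPrecoverage = S

/-- Continuous functors between categories with coverings: coverings are sent to coverings, and
fibre products of members of coverings with arbitrary maps exist and are preserved. -/
structure IsContinuousFunctor {C D : Type*} [Category* C] [Category* D]
    (S : Precoverage C) (T : Precoverage D) (F : C ⥤ D) : Prop where
  map_covering : ∀ (U : C) (R : Presieve U), R ∈ S U → R.map F ∈ T (F.obj U)
  hasPullback : ∀ (U : C) (R : Presieve U), R ∈ S U → ∀ (W : C) (f : W ⟶ U), R f →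
    ∀ (V : C) (g : V ⟶ U), HasPullback g f
  map_isPullback : ∀ (U : C) (R : Presieve U), R ∈ S U → ∀ (W : C) (f : W ⟶ U), R f →
    ∀ (V : C) (g : V ⟶ U) (P : C) (fst : P ⟶ V) (snd : P ⟶ W), IsPullback fst snd g f →
      IsPullback (F.map fst) (F.map snd) (F.map g) (F.map f)

end StoneDelta

end

open StoneDelta

noncomputable section

namespace StoneDelta

/-! On a Stone `δ`-ring the Frobenius lift is the identity, so `A` is `p`-torsion-free with `a = a ^
p + p * δ a`, and `A ≅ W(A / p)` with `A / p` a `p`-Boolean ring. That equation makes ring maps that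
agree modulo `p` agree modulo every power of `p`; together with functoriality of `W`, reduction
modulo `p` is fully faithful into `p`-Boolean rings. Its essential image is cut out by size
(`isCountablyPresented_iff`): finite in the algebraic sense, countable in the `p`-complete sense.

Everything then happens in `p`-Boolean rings. Their residue fields are `𝔽_p`, so the points of `A`
are the primes of `A / p`, and a continuous bijection from a compact to a Hausdorff space is a
homeomorphism. All their modules are flat, and `p` is regular on Stone `δ`-rings, so a finite family
is a covering exactly when it is jointly surjective on points
(`isPCompletelyFaithfullyFlat_pi_iff`).

Tensor products of `p`-Boolean rings and the initial one, `𝔽_p`, give `TD` finite limits. As a set,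
`u(A)` is the set of maps to `A` from the terminal object `ℤ_p`, so `u` preserves finite limits.
Hence `u` is flat and cover-preserving, and restriction along it is `ψ_*`. As `TD` is essentially
small, the left Kan extension is pointwise a filtered colimit; it and sheafification are left exact,
hence so is `ψ^*`. -/

/-! ### Rings in which every element is a fixed point of Frobenius -/

/-- The underlying rings of `p`-Boolean algebras. -/
structure IsPBool (p : ℕ) (R : Type) [CommRing R] : Prop where
  cast_eq_zero : (p : R) = 0
  pow_eq : ∀ a : R, a ^ p = a

theorem PBoolean.isPBool {p : ℕ} (R : PBoolean p) : IsPBool p R.carrier :=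
  ⟨by rw [← map_natCast (algebraMap (ZMod p) R.carrier)]; simp, R.pow_eq⟩

namespace IsPBool

variable {p : ℕ} {R S : Type} [CommRing R] [CommRing S]

/-- The structure map of an `𝔽_p`-algebra. -/
def ofZMod (h : IsPBool p R) : ZMod p →+* R := ZMod.castHom (ringChar.dvd h.cast_eq_zero) R

/-- The `p`-Boolean algebra with a given underlying ring. -/
def toPBoolean (h : IsPBool p R) : PBoolean p :=
  letI := h.ofZMod.toAlgebra
  ⟨R, h.pow_eq⟩

theorem of_surjective (h : IsPBool p R) (f : R →+* S) (hf : Function.Surjective f) :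
    IsPBool p S := by
  refine ⟨by rw [← map_natCast f, h.cast_eq_zero, map_zero], fun a => ?_⟩
  obtain ⟨b, rfl⟩ := hf a
  rw [← map_pow, h.pow_eq]

theorem zmod (p : ℕ) [Fact p.Prime] : IsPBool p (ZMod p) :=
  ⟨by simp, ZMod.pow_card⟩

variable [hp : Fact p.Prime]

theorem frobenius_eq (h : IsPBool p R) (x : WittVector p R) : WittVector.frobenius x = x :=
  h.toPBoolean.witt_frobenius_eq x

/-- `FV = p` and `F = id`. Thus the `p`-adic and the Verschiebung filtrations coincide. -/
theorem verschiebung_eq (h : IsPBool p R) (x : WittVector p R) :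
    WittVector.verschiebung x = p * x := by
  rw [mul_comm, ← WittVector.frobenius_verschiebung, h.frobenius_eq]

theorem pow_mul_eq (h : IsPBool p R) (m : ℕ) (x : WittVector p R) :
    (p : WittVector p R) ^ m * x = WittVector.verschiebung^[m] x := by
  induction m generalizing x with
  | zero => simp
  | succ m ih =>
    rw [Function.iterate_succ_apply, ← ih, h.verschiebung_eq]
    ring

theorem torsionFree (h : IsPBool p R) (x : WittVector p R) (hx : (p : WittVector p R) * x = 0) :
    x = 0 :=
  h.toPBoolean.witt_torsionFree x hx

theorem ker_constantCoeff (h : IsPBool p R) :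
    RingHom.ker (WittVector.constantCoeff : WittVector p R →+* R) =
      Ideal.span {(p : WittVector p R)} := by
  ext x
  rw [RingHom.mem_ker, Ideal.mem_span_singleton]
  constructor
  · intro hx
    have h2 := WittVector.verschiebung_shift x 0 (by
      intro i hi
      rcases Nat.lt_one_iff.1 hi
      exact hx)
    have h3 : x.shift 0 = x := by
      ext n
      simp [WittVector.shift]
    exact ⟨_, by rw [← h.verschiebung_eq, h2, h3]⟩
  · rintro ⟨y, rfl⟩
    rw [← h.verschiebung_eq]
    exact WittVector.verschiebung_coeff_zero y

end IsPBool

/-! ### Stone delta-rings -/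

/-- Intrinsic description of Stone `δ`-rings. -/
structure StoneRing (p : ℕ) [Fact p.Prime] (A : Type) [CommRing A] [DeltaRing p A] : Prop where
  torsionFree : ∀ x : A, (p : A) * x = 0 → x = 0
  eq_pow_add : ∀ x : A, x = x ^ p + p * DeltaRing.δ p x
  exists_equiv : ∃ e : A ≃+* WittVector p (ModP p A),
    ∀ a, (e a).coeff 0 = Ideal.Quotient.mk _ a

section

variable {p : ℕ} [hp : Fact p.Prime] {A B : Type} [CommRing A] [CommRing B]

/-- The reduction of a ring isomorphic to `W(R)` is `R`. -/
def modPEquiv {R : Type} [CommRing R] (h : IsPBool p R) (e : A ≃+* WittVector p R) :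
    ModP p A ≃+* R :=
  (Ideal.quotEquivOfEq (by
    ext x
    rw [← RingHom.comap_ker, h.ker_constantCoeff, Ideal.mem_comap, Ideal.mem_span_singleton,
      Ideal.mem_span_singleton]
    have := map_dvd_iff e (a := (p : A)) (b := x)
    rw [map_natCast] at this
    exact this.symm)).trans
  (RingHom.quotientKerEquivOfSurjective
    (f := (WittVector.constantCoeff : WittVector p R →+* R).comp (e : A →+* WittVector p R))
    (by
      intro r
      obtain ⟨x, hx⟩ := e.surjective (WittVector.teichmuller p r)
      refine ⟨x, ?_⟩
      change WittVector.constantCoeff (e x) = r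
      rw [hx]
      exact WittVector.teichmuller_coeff_zero p r))

theorem modPEquiv_mk {R : Type} [CommRing R] (h : IsPBool p R) (e : A ≃+* WittVector p R)
    (a : A) : modPEquiv h e (Ideal.Quotient.mk _ a) = (e a).coeff 0 := rfl

/-- Normalises an arbitrary isomorphism with some `W(R)`: `R` is replaced by `A / p`, and the zeroth
coefficient becomes the reduction map. -/
theorem StoneRing.of_equiv [DeltaRing p A] (tf : ∀ x : A, (p : A) * x = 0 → x = 0)
    (eq : ∀ x : A, x = x ^ p + p * DeltaRing.δ p x) {R : Type} [CommRing R] (h : IsPBool p R)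
    (e : A ≃+* WittVector p R) : StoneRing p A := by
  refine ⟨tf, eq, RingEquiv.ofBijective
    ((WittVector.map ((modPEquiv h e).symm : R →+* ModP p A)).comp (e : A →+* WittVector p R))
    ⟨?_, ?_⟩, ?_⟩
  · exact (WittVector.map_injective _ (modPEquiv h e).symm.injective).comp e.injective
  · exact (WittVector.map_surjective _ (modPEquiv h e).symm.surjective).comp e.surjective
  · intro a
    change (WittVector.map _ (e a)).coeff 0 = _
    rw [WittVector.map_coeff, ← modPEquiv_mk h e]
    exact (modPEquiv h e).symm_apply_apply _

/-- An isomorphism of `δ`-rings gives an isomorphism of rings. -/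
def ringEquivOfIso {A B : DeltaRingCat p} (e : A ≅ B) : A ≃+* B :=
  RingEquiv.ofRingHom (DeltaHom.toRingHom e.hom) (DeltaHom.toRingHom e.inv)
    (congrArg DeltaHom.toRingHom e.inv_hom_id) (congrArg DeltaHom.toRingHom e.hom_inv_id)

theorem PBoolean.witt_eq_pow_add (R : PBoolean p) (x : R.witt) :
    x = x ^ p + p * DeltaRing.δ p x :=
  (R.witt_frobenius_eq x).symm.trans (R.witt_frobenius x).choose_spec

theorem IsStone.stoneRing {A : DeltaRingCat p} (h : IsStone p A) : StoneRing p A := by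
  obtain ⟨R, ⟨e⟩⟩ := h
  refine StoneRing.of_equiv (fun x hx => ?_) (fun x => ?_) R.isPBool (ringEquivOfIso e)
  · apply (ringEquivOfIso e).injective
    rw [map_zero]
    apply R.witt_torsionFree
    have := congrArg (ringEquivOfIso e) hx
    rw [map_mul, map_natCast, map_zero] at this
    exact this
  · apply (ringEquivOfIso e).injective
    rw [map_add, map_pow, map_mul, map_natCast]
    have : ringEquivOfIso e (DeltaRing.δ p x) = DeltaRing.δ p (ringEquivOfIso e x) :=
      DeltaHom.map_delta e.hom x
    rw [this]
    exact R.witt_eq_pow_add _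

theorem padicInt_stoneRing (p : ℕ) [hp : Fact p.Prime] : StoneRing p ℤ_[p] :=
  StoneRing.of_equiv
    (fun x hx => (mul_eq_zero.1 hx).resolve_left (by exact_mod_cast hp.out.ne_zero))
    (padicInt_delta p) (IsPBool.zmod p) (WittVector.equiv p).symm

theorem PBoolean.witt_stoneRing (R : PBoolean p) : StoneRing p R.witt :=
  StoneRing.of_equiv R.witt_torsionFree R.witt_eq_pow_add R.isPBool (RingEquiv.refl _)

/-- In the binomial expansion the middle terms gain a factor `p` from their coefficients, and the
last has exponent `p(n + 1) ≥ n + 2`. -/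
theorem pow_dvd_pow_sub_pow {x y : A} {n : ℕ} (h : (p : A) ^ (n + 1) ∣ x - y) :
    (p : A) ^ (n + 1 + 1) ∣ x ^ p - y ^ p := by
  obtain ⟨c, hc⟩ := h
  have hx : x = y + p ^ (n + 1) * c := by rw [← hc]; ring
  rw [hx, add_pow_prime, add_assoc (y ^ p), add_sub_cancel_left]
  refine dvd_add ?_ ?_
  · rw [mul_pow, ← pow_mul]
    refine Dvd.dvd.mul_right (pow_dvd_pow _ ?_) _
    have := hp.out.two_le
    nlinarith
  · rw [pow_succ' _ (n + 1)]
    refine mul_dvd_mul_left _ (Finset.dvd_sum fun i hi => Dvd.dvd.mul_left ?_ _)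
    rw [Finset.mem_Ioo] at hi
    exact dvd_pow (Dvd.intro _ rfl) (by omega)

/-- In `a = a ^ p + p * δ a` both summands improve a congruence by one power of `p`; the induction
needs it for `δ a` as well as for `a`. -/
theorem StoneRing.dvd_sub_of_dvd_sub [DeltaRing p A] (hA : StoneRing p A) (f g : A →+* B)
    (h : ∀ a, (p : B) ∣ f a - g a) (n : ℕ) (a : A) : (p : B) ^ (n + 1) ∣ f a - g a := by
  induction n generalizing a with
  | zero => simpa using h a
  | succ n ih =>
    have e : f a - g a = (f a ^ p - g a ^ p) +
        p * (f (DeltaRing.δ p a) - g (DeltaRing.δ p a)) := by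
      have h1 := congrArg f (hA.eq_pow_add a)
      have h2 := congrArg g (hA.eq_pow_add a)
      rw [map_add, map_pow, map_mul, map_natCast] at h1 h2
      linear_combination h1 - h2
    rw [e]
    refine dvd_add ?_ ?_
    · exact pow_dvd_pow_sub_pow (ih a)
    · rw [pow_succ' _ (n + 1)]
      exact mul_dvd_mul_left _ (ih _)

namespace StoneRing

variable [DeltaRing p A] [DeltaRing p B]

theorem isPBool (h : StoneRing p A) : IsPBool p (ModP p A) := by
  have hp0 : (p : ModP p A) = 0 := by
    rw [← map_natCast (Ideal.Quotient.mk (Ideal.span {(p : A)})), Ideal.Quotient.eq_zero_iff_mem]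
    exact Ideal.mem_span_singleton_self _
  refine ⟨hp0, fun a => ?_⟩
  obtain ⟨a, rfl⟩ := Ideal.Quotient.mk_surjective a
  conv_rhs => rw [h.eq_pow_add a]
  simp [hp0]

/-- Ring homomorphisms between Stone `δ`-rings preserve `δ`. -/
theorem map_delta (hA : StoneRing p A) (hB : StoneRing p B) (f : A →+* B) (x : A) :
    f (DeltaRing.δ p x) = DeltaRing.δ p (f x) := by
  rw [← sub_eq_zero]
  apply hB.torsionFree
  have h1 := congrArg f (hA.eq_pow_add x)
  have h2 := hB.eq_pow_add (f x)
  rw [map_add, map_pow, map_mul, map_natCast] at h1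
  linear_combination h2 - h1

/-- A ring homomorphism between Stone `δ`-rings, as a homomorphism of `δ`-rings. -/
def deltaHom (hA : StoneRing p A) (hB : StoneRing p B) (f : A →+* B) : DeltaHom p A B :=
  ⟨f, hA.map_delta hB f⟩

/-- Stone `δ`-rings are `p`-adically separated. -/
theorem eq_zero_of_pow_dvd (h : StoneRing p A) (x : A) (hx : ∀ n : ℕ, (p : A) ^ n ∣ x) :
    x = 0 := by
  obtain ⟨e, -⟩ := h.exists_equiv
  apply e.injective
  rw [map_zero]
  ext n
  obtain ⟨y, hy⟩ := hx (n + 1)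
  rw [hy, map_mul, map_pow, map_natCast, h.isPBool.pow_mul_eq,
    WittVector.iterate_verschiebung_coeff_eq_zero _ (Nat.lt_succ_self n)]
  simp

theorem ringHom_ext (hA : StoneRing p A) (hB : StoneRing p B) (f g : A →+* B)
    (h : mapModP p f = mapModP p g) : f = g := by
  ext a
  rw [← sub_eq_zero]
  refine hB.eq_zero_of_pow_dvd _ fun n => ?_
  refine (pow_dvd_pow _ n.le_succ).trans (hA.dvd_sub_of_dvd_sub f g (fun a => ?_) n a)
  have := RingHom.congr_fun h (Ideal.Quotient.mk _ a)
  rw [← Ideal.mem_span_singleton, ← Ideal.Quotient.eq]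
  exact this

/-- Transport `WittVector.map h` along the normalised isomorphisms; its zeroth coefficient is `h`.
With `ringHom_ext` this gives full faithfulness of reduction. -/
theorem exists_lift (hA : StoneRing p A) (hB : StoneRing p B) (h : ModP p A →+* ModP p B) :
    ∃ f : A →+* B, mapModP p f = h := by
  obtain ⟨eA, hA'⟩ := hA.exists_equiv
  obtain ⟨eB, hB'⟩ := hB.exists_equiv
  refine ⟨(eB.symm : WittVector p (ModP p B) →+* B).comp ((WittVector.map h).comp
    (eA : A →+* WittVector p (ModP p A))), ?_⟩
  refine Ideal.Quotient.ringHom_ext (RingHom.ext fun a => ?_)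
  change Ideal.Quotient.mk _ (eB.symm (WittVector.map h (eA a))) = h (Ideal.Quotient.mk _ a)
  rw [← hB', eB.apply_symm_apply, WittVector.map_coeff, hA']

end StoneRing

end

/-! ### Flatness, spectra and residue fields of `p`-Boolean rings -/

namespace IsPBool

variable {p : ℕ} {R S : Type} [CommRing R] [CommRing S]

theorem ideal_isIdempotentElem (h : IsPBool p R) [hp : Fact p.Prime] (I : Ideal R) :
    IsIdempotentElem I := by
  refine le_antisymm Ideal.mul_le_right fun a ha => ?_
  rw [← h.pow_eq a, ← Nat.sub_add_cancel hp.out.one_le, pow_succ]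
  have : p - 1 ≠ 0 := by have := hp.out.two_le; omega
  exact Ideal.mul_mem_mul (Ideal.pow_mem_of_mem I ha _ (Nat.pos_of_ne_zero this)) ha

/-- Every module over a `p`-Boolean ring is flat. -/
theorem flat (h : IsPBool p R) [Fact p.Prime] (M : Type) [AddCommGroup M] [Module R M] :
    Module.Flat R M := by
  rw [Module.Flat.iff_lift_lsmul_comp_subtype_injective]
  intro I hI
  -- A finitely generated idempotent ideal is generated by an idempotent `e`, so every tensor has
  -- the form `e ⊗ m`.
  obtain ⟨e, he, rfl⟩ := (Ideal.isIdempotentElem_iff_of_fg I hI).1 (h.ideal_isIdempotentElem I)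
  have hmem : e ∈ Ideal.span {e} := Ideal.mem_span_singleton_self e
  have key : ∀ x : TensorProduct R (Ideal.span {e} : Ideal R) M, ∃ m : M, x = ⟨e, hmem⟩ ⊗ₜ m := by
    intro x
    induction x using TensorProduct.induction_on with
    | zero => exact ⟨0, by simp⟩
    | tmul r m =>
      obtain ⟨r, hr⟩ := r
      obtain ⟨c, rfl⟩ := Ideal.mem_span_singleton'.1 hr
      refine ⟨c • m, ?_⟩
      rw [TensorProduct.tmul_smul, TensorProduct.smul_tmul']
      rfl
    | add x y hx hy =>
      obtain ⟨m, rfl⟩ := hx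
      obtain ⟨n, rfl⟩ := hy
      exact ⟨m + n, (TensorProduct.tmul_add _ _ _).symm⟩
  rw [← LinearMap.ker_eq_bot, LinearMap.ker_eq_bot']
  intro x hx
  obtain ⟨m, rfl⟩ := key x
  have hm : e • m = 0 := by simpa using hx
  -- If `e • m = 0`, then `e ⊗ m = e² ⊗ m = e ⊗ (e • m) = 0`.
  have : (⟨e, hmem⟩ : (Ideal.span {e} : Ideal R)) = e • ⟨e, hmem⟩ := Subtype.ext he.eq.symm
  rw [this, TensorProduct.smul_tmul, hm, TensorProduct.tmul_zero]

/-- For `a` in one prime and not in the other, `a ^ (p - 1)` is an idempotent whose complementary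
basic opens separate them. -/
theorem t2Space (h : IsPBool p R) [hp : Fact p.Prime] : T2Space (PrimeSpectrum R) := by
  have key : ∀ (x y : PrimeSpectrum R) (a : R), a ∈ x.asIdeal → a ∉ y.asIdeal →
      ∃ u v : Set (PrimeSpectrum R), IsOpen u ∧ IsOpen v ∧ x ∈ u ∧ y ∈ v ∧ Disjoint u v := by
    intro x y a hx hy
    have h0 : a * (1 - a ^ (p - 1)) = 0 := by
      rw [mul_sub, mul_one, ← pow_succ', Nat.sub_add_cancel hp.out.one_le, h.pow_eq, sub_self]
    refine ⟨PrimeSpectrum.basicOpen (1 - a ^ (p - 1)), PrimeSpectrum.basicOpen a,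
      PrimeSpectrum.isOpen_basicOpen, PrimeSpectrum.isOpen_basicOpen, ?_, hy, ?_⟩
    · intro h1
      refine x.isPrime.ne_top ((Ideal.eq_top_iff_one _).2 ?_)
      have : p - 1 ≠ 0 := by have := hp.out.two_le; omega
      have h2 := Ideal.pow_mem_of_mem _ hx _ (Nat.pos_of_ne_zero this)
      simpa using add_mem h1 h2
    · rw [Set.disjoint_left]
      intro z hz hz'
      have : a * (1 - a ^ (p - 1)) ∈ z.asIdeal := by rw [h0]; exact zero_mem _
      exact (z.isPrime.mem_or_mem this).elim hz' hz
  refine ⟨fun x y hxy => ?_⟩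
  by_cases hle : x.asIdeal ≤ y.asIdeal
  · have : ¬ y.asIdeal ≤ x.asIdeal := fun h' => hxy (PrimeSpectrum.ext (le_antisymm hle h'))
    obtain ⟨a, ha, ha'⟩ := SetLike.not_le_iff_exists.1 this
    obtain ⟨u, v, hu, hv, h1, h2, h3⟩ := key y x a ha ha'
    exact ⟨v, u, hv, hu, h2, h1, h3.symm⟩
  · obtain ⟨a, ha, ha'⟩ := SetLike.not_le_iff_exists.1 hle
    exact key x y a ha ha'

/-- The `p`-Boolean domains are the fields with `p` elements. -/
theorem bijective_zmod (h : IsPBool p R) [hp : Fact p.Prime] [IsDomain R] :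
    Function.Bijective h.ofZMod := by
  classical
  refine ⟨h.ofZMod.injective, fun a => ?_⟩
  -- Every element is a root of `X ^ p - X`, which has at most `p` roots in a domain; the `p`
  -- elements of `𝔽_p` already exhaust them.
  obtain ⟨P, hP⟩ : ∃ P : Polynomial R, P = Polynomial.X ^ p - Polynomial.X := ⟨_, rfl⟩
  have hP0 : P ≠ 0 := by
    intro h0
    have := congrArg (fun Q : Polynomial R => Q.coeff p) (hP.symm.trans h0)
    simp [Polynomial.coeff_X, hp.out.ne_one.symm] at this
  have hroot : ∀ b, b ∈ P.roots.toFinset := fun b => by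
    rw [Multiset.mem_toFinset, Polynomial.mem_roots hP0, hP]
    simp [h.pow_eq]
  have hdeg : P.natDegree ≤ p := by
    rw [hP]
    refine (Polynomial.natDegree_sub_le_of_le (Polynomial.natDegree_X_pow_le p)
      ((Polynomial.natDegree_X_le (R := R)).trans hp.out.one_le)).trans (max_self p).le
  have hcard : P.roots.toFinset.card ≤ p :=
    (Multiset.toFinset_card_le _).trans ((Polynomial.card_roots' P).trans hdeg)
  have himg : Finset.univ.image h.ofZMod = P.roots.toFinset := by
    refine Finset.eq_of_subset_of_card_le (fun b _ => hroot b) ?_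
    rw [Finset.card_image_of_injective _ h.ofZMod.injective, Finset.card_univ, ZMod.card]
    exact hcard
  have := hroot a
  rw [← himg, Finset.mem_image] at this
  obtain ⟨c, -, hc⟩ := this
  exact ⟨c, hc⟩

/-- The residue field at a prime of a `p`-Boolean ring. -/
def residueEquiv (h : IsPBool p R) [hp : Fact p.Prime] (q : Ideal R) [q.IsPrime] :
    ZMod p ≃+* R ⧸ q :=
  RingEquiv.ofBijective _
    (h.of_surjective (Ideal.Quotient.mk q) Ideal.Quotient.mk_surjective).bijective_zmod

theorem exists_ker_eq (h : IsPBool p R) [hp : Fact p.Prime] (q : Ideal R) [q.IsPrime] :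
    ∃ f : R →+* ZMod p, RingHom.ker f = q := by
  refine ⟨((h.residueEquiv q).symm : R ⧸ q →+* ZMod p).comp (Ideal.Quotient.mk q), ?_⟩
  ext a
  rw [RingHom.mem_ker, RingHom.comp_apply, ← Ideal.Quotient.eq_zero_iff_mem]
  exact (h.residueEquiv q).symm.map_eq_zero_iff

end IsPBool

/-- Each value `f a` is the image of an integer `n`, and `a - n` lies in the common kernel. -/
theorem eq_of_ker_eq {p : ℕ} [Fact p.Prime] {R : Type} [CommRing R] (f g : R →+* ZMod p)
    (h : RingHom.ker f = RingHom.ker g) : f = g := by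
  ext a
  have hc : ∀ h : R →+* ZMod p, h ((f a).val : R) = f a := fun h => by
    rw [map_natCast, ZMod.natCast_zmod_val]
  have h1 : a - ((f a).val : R) ∈ RingHom.ker f := by rw [RingHom.mem_ker, map_sub, hc, sub_self]
  rw [h, RingHom.mem_ker, map_sub, hc] at h1
  exact (sub_eq_zero.1 h1).symm

/-! ### Comparison with the spectrum -/

section

variable {p : ℕ} [hp : Fact p.Prime]

/-- The reduction of `ℤ_p`. -/
def modPPadicInt (p : ℕ) [Fact p.Prime] : ModP p ℤ_[p] ≃+* ZMod p :=
  modPEquiv (IsPBool.zmod p) (WittVector.equiv p).symm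

/-- Comparing kernels suffices, so `modPPadicInt` need not be computed. -/
theorem residue_eq {A : DeltaRingCat p} (f : Points p A) :
    residue f = (modPPadicInt p : ModP p ℤ_[p] →+* ZMod p).comp (mapModP p f.toRingHom) := by
  apply eq_of_ker_eq
  ext a
  obtain ⟨a, rfl⟩ := Ideal.Quotient.mk_surjective a
  rw [RingHom.mem_ker, RingHom.mem_ker, RingHom.comp_apply]
  refine Iff.trans ?_ (modPPadicInt p).map_eq_zero_iff.symm
  change PadicInt.toZMod (f.toRingHom a) = 0 ↔ Ideal.Quotient.mk _ (f.toRingHom a) = 0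
  rw [Ideal.Quotient.eq_zero_iff_mem, ← RingHom.mem_ker, PadicInt.ker_toZMod,
    PadicInt.maximalIdeal_eq_span_p]

theorem exists_residue_eq {A : DeltaRingCat p} (hA : StoneRing p A) (h : ModP p A →+* ZMod p) :
    ∃ f : Points p A, residue f = h := by
  obtain ⟨f, hf⟩ := hA.exists_lift (padicInt_stoneRing p)
    (((modPPadicInt p).symm : ZMod p →+* ModP p ℤ_[p]).comp h)
  refine ⟨hA.deltaHom (padicInt_stoneRing p) f, ?_⟩
  rw [residue_eq]
  change (modPPadicInt p : ModP p ℤ_[p] →+* ZMod p).comp (mapModP p f) = h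
  rw [hf]
  ext a
  exact (modPPadicInt p).apply_symm_apply _

theorem toSpec_bijective {A : DeltaRingCat p} (hA : StoneRing p A) :
    Function.Bijective (toSpec A) := by
  constructor
  · intro f g h
    exact residue_injective f g
      (RingHom.congr_fun (eq_of_ker_eq _ _ (congrArg PrimeSpectrum.asIdeal h)))
  · intro q
    obtain ⟨h, hq⟩ := hA.isPBool.exists_ker_eq q.asIdeal
    obtain ⟨f, rfl⟩ := exists_residue_eq hA h
    exact ⟨f, PrimeSpectrum.ext hq⟩

theorem continuous_toSpec (A : DeltaRingCat p) : Continuous (toSpec A) := by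
  rw [PrimeSpectrum.isTopologicalBasis_basic_opens.continuous_iff]
  rintro _ ⟨a, rfl⟩
  exact (isOpen_discrete {0}ᶜ).preimage (continuous_residue A a)

theorem isHomeomorph_toSpec {A : DeltaRingCat p} (hA : StoneRing p A) :
    IsHomeomorph (toSpec A) := by
  have := hA.isPBool.t2Space
  rw [isHomeomorph_iff_continuous_bijective]
  exact ⟨continuous_toSpec A, toSpec_bijective hA⟩

theorem toSpec_precomp {A B : DeltaRingCat p} (g : A ⟶ B) (f : Points p B) :
    toSpec A (precomp g f) =
      PrimeSpectrum.comap (mapModP p (DeltaHom.toRingHom g)) (toSpec B f) := by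
  ext a
  obtain ⟨a, rfl⟩ := Ideal.Quotient.mk_surjective a
  rfl

end

/-! ### Torsion with respect to a regular element -/

section Tor

open scoped TensorProduct

/-- Applied with `F` the identity, to obtain a resolution, and with `F` a tensor functor, to compute
Tor. -/
theorem exactAt_double {C D : Type*} [Category* C] [Category* D] [Abelian C] [Abelian D]
    (F : C ⥤ D) [F.Additive] {X Y : C} (f : X ⟶ Y) [Mono (F.map f)]
    (h : (ComplexShape.down ℕ).Rel 1 0) (n : ℕ) :
    ((F.mapHomologicalComplex _).obj (HomologicalComplex.double f h)).ExactAt (n + 1) := by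
  rw [HomologicalComplex.exactAt_iff' _ (n + 2) (n + 1) n (by simp) (by simp)]
  cases n with
  | zero =>
    rw [ShortComplex.exact_iff_mono]
    · change Mono (F.map ((HomologicalComplex.double f h).d 1 0))
      rw [HomologicalComplex.double_d f h one_ne_zero, F.map_comp, F.map_comp]
      infer_instance
    · change F.map ((HomologicalComplex.double f h).d 2 1) = 0
      rw [HomologicalComplex.double_d_eq_zero₀ f h _ _ (by simp), F.map_zero]
  | succ n =>
    apply ShortComplex.exact_of_isZero_X₂
    exact F.map_isZero (HomologicalComplex.isZero_double_X f h (n + 2) (by simp) (by simp))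

variable {A : Type} [CommRing A]

/-- The resolution of `A / a` by `a : A → A`. -/
def quotientResolution (a : A) (ha : ∀ x : A, a * x = 0 → x = 0) :
    ProjectiveResolution (ModuleCat.of A (A ⧸ Ideal.span {a})) := by
  let f : ModuleCat.of A A ⟶ ModuleCat.of A A := ModuleCat.ofHom (LinearMap.lsmul A A a)
  let g : ModuleCat.of A A ⟶ ModuleCat.of A (A ⧸ Ideal.span {a}) :=
    ModuleCat.ofHom (Submodule.mkQ _)
  have hfg : f ≫ g = 0 := by
    ext
    change Ideal.Quotient.mk _ (a * 1) = 0
    rw [mul_one, Ideal.Quotient.eq_zero_iff_mem]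
    exact Ideal.mem_span_singleton_self a
  have hf : Mono f := by
    rw [ModuleCat.mono_iff_injective]
    exact (injective_iff_map_eq_zero _).2 ha
  have hrel : (ComplexShape.down ℕ).Rel 1 0 := rfl
  let K := HomologicalComplex.double f hrel
  let π₀ : K.X 0 ⟶ ModuleCat.of A (A ⧸ Ideal.span {a}) :=
    (HomologicalComplex.doubleXIso₁ f hrel one_ne_zero).hom ≫ g
  have hd : K.d 1 0 ≫ π₀ = 0 := by
    simp [K, π₀, HomologicalComplex.double_d f hrel one_ne_zero, hfg]
  refine
    { complex := K
      projective := fun n => ?_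
      π := (ChainComplex.toSingle₀Equiv _ _).symm ⟨π₀, hd⟩
      quasiIso := ⟨fun n => ?_⟩ }
  · rcases n with _ | _ | n
    · exact Projective.of_iso (HomologicalComplex.doubleXIso₁ f hrel one_ne_zero).symm
        inferInstance
    · exact Projective.of_iso (HomologicalComplex.doubleXIso₀ f hrel).symm inferInstance
    · exact (HomologicalComplex.isZero_double_X f hrel (n + 2) (by simp) (by simp)).projective
  · rcases n with _ | n
    -- In degree zero the claim is exactness of `A → A → A / a → 0`.
    · rw [ChainComplex.quasiIsoAt₀_iff, ShortComplex.quasiIso_iff_of_zeros' _ (by simp; rfl) rfl rfl]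
      have hex : (ShortComplex.mk f g hfg).Exact := by
        rw [ShortComplex.moduleCat_exact_iff]
        intro x hx
        obtain ⟨c, hc⟩ := Ideal.mem_span_singleton'.1 (Ideal.Quotient.eq_zero_iff_mem.1 hx)
        exact ⟨c, (mul_comm a c).trans hc⟩
      have hg : Epi g := (ModuleCat.epi_iff_surjective g).2 Ideal.Quotient.mk_surjective
      have hex' : (ShortComplex.mk (K.d 1 0) π₀ hd).Exact := by
        let φ : ShortComplex.mk f g hfg ≅ ShortComplex.mk (K.d 1 0) π₀ hd :=
          ShortComplex.isoMk (HomologicalComplex.doubleXIso₀ f hrel).symm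
            (HomologicalComplex.doubleXIso₁ f hrel one_ne_zero).symm (Iso.refl _)
            (by simp [HomologicalComplex.double_d f hrel one_ne_zero, K]) (by simp [π₀])
        exact ShortComplex.exact_of_iso φ hex
      constructor
      · exact hex'
      · change Epi π₀
        infer_instance
    · rw [quasiIsoAt_iff_exactAt' (hL := ChainComplex.exactAt_succ_single_obj ..)]
      exact exactAt_double (𝟭 _) f hrel n

/-- The resolution has length one, so only the first Tor could survive, and it is the `a`-torsion of
`M ⊗ A ≅ M`. -/
theorem isZero_tor (a : A) (ha : ∀ x : A, a * x = 0 → x = 0) (M : ModuleCat.{0} A)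
    (hM : ∀ x : M, a • x = 0 → x = 0) (n : ℕ) :
    IsZero (((Tor (ModuleCat.{0} A) (n + 1)).obj M).obj
      (ModuleCat.of A (A ⧸ Ideal.span {a}))) := by
  refine IsZero.of_iso ?_ ((quotientResolution a ha).isoLeftDerivedObj _ (n + 1))
  have : Mono (((MonoidalCategory.tensoringLeft (ModuleCat.{0} A)).obj M).map
      (ModuleCat.ofHom (LinearMap.lsmul A A a) : ModuleCat.of A A ⟶ ModuleCat.of A A)) := by
    rw [ModuleCat.mono_iff_injective]
    change Function.Injective (LinearMap.lTensor M (LinearMap.lsmul A A a))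
    have h : LinearMap.lTensor M (LinearMap.lsmul A A a) =
        a • (LinearMap.id : TensorProduct A M A →ₗ[A] _) := by
      ext m
      change m ⊗ₜ[A] (a * 1) = a • m ⊗ₜ[A] (1 : A)
      rw [← TensorProduct.tmul_smul, smul_eq_mul]
    rw [h]
    refine (injective_iff_map_eq_zero _).2 fun z hz => ?_
    apply (TensorProduct.rid A M).injective
    rw [map_zero]
    apply hM
    rw [← map_smul]
    exact (congrArg _ hz).trans (map_zero _)
  exact (exactAt_double _ _ rfl n).isZero_homology

end Tor

/-! ### Coverings -/

section

variable {p : ℕ} [hp : Fact p.Prime]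

/-- Tor vanishes because `p` is regular on `A` and on every `B i`, and flatness is automatic over `A
/ p`. What remains is surjectivity on spectra, that is, on points. -/
theorem isPCompletelyFaithfullyFlat_pi_iff {n : ℕ} {A : DeltaRingCat p}
    {B : Fin n → DeltaRingCat p} (f : ∀ i, A ⟶ B i) (hA : StoneRing p A)
    (hB : ∀ i, StoneRing p (B i)) :
    IsPCompletelyFaithfullyFlat p (RingHom.pi fun i => DeltaHom.toRingHom (f i)) ↔
      ∀ x : Points p A, ∃ (i : Fin n) (y : Points p (B i)), precomp (f i) y = x := by
  set F : A →+* ∀ i, B i := RingHom.pi fun i => DeltaHom.toRingHom (f i) with hF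
  have hcomap : ∀ (i : Fin n) (y : Points p (B i)), PrimeSpectrum.comap (mapModP p F)
      (PrimeSpectrum.comap (mapModP p (Pi.evalRingHom (fun i => (B i : Type)) i))
        (toSpec (B i) y)) = toSpec A (precomp (f i) y) := by
    intro i y
    rw [toSpec_precomp]
    ext a
    obtain ⟨a, rfl⟩ := Ideal.Quotient.mk_surjective a
    rfl
  constructor
  · rintro ⟨-, hff⟩ x
    obtain ⟨Q, hQ⟩ := (RingHom.FaithfullyFlat.iff_flat_and_comap_surjective.1 hff).2 (toSpec A x)
    -- A prime of a finite product comes from a single factor; since it contains `p`, it descends to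
    -- `B i / p`.
    obtain ⟨⟨i, q⟩, hq⟩ := (PrimeSpectrum.sigmaToPi_bijective fun i => (B i : Type)).2
      (PrimeSpectrum.comap (Ideal.Quotient.mk _) Q)
    have hq' : PrimeSpectrum.comap (Pi.evalRingHom (fun i => (B i : Type)) i) q =
      PrimeSpectrum.comap (Ideal.Quotient.mk _) Q := hq
    have hpq : q ∈ Set.range (PrimeSpectrum.comap (Ideal.Quotient.mk (Ideal.span {(p : B i)}))) := by
      rw [range_comap_of_surjective _ _ Ideal.Quotient.mk_surjective,
        Ideal.mk_ker, PrimeSpectrum.mem_zeroLocus, SetLike.coe_subset_coe,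
        Ideal.span_singleton_le_iff_mem]
      have h1 : (p : ∀ i, B i) ∈ (PrimeSpectrum.comap (Ideal.Quotient.mk _) Q).asIdeal := by
        rw [PrimeSpectrum.comap_asIdeal, Ideal.mem_comap,
          Ideal.Quotient.eq_zero_iff_mem.2 (Ideal.mem_span_singleton_self _)]
        exact zero_mem _
      rw [← hq'] at h1
      exact h1
    obtain ⟨q', rfl⟩ := hpq
    obtain ⟨y, rfl⟩ := (toSpec_bijective (hB i)).2 q'
    refine ⟨i, y, (toSpec_bijective hA).1 ?_⟩
    rw [← hcomap, ← hQ]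
    congr 1
    exact PrimeSpectrum.comap_injective_of_surjective _ Ideal.Quotient.mk_surjective hq'
  · intro hsurj
    refine ⟨fun i => isZero_tor (p : A) hA.torsionFree _ (fun x hx => ?_) i,
      RingHom.FaithfullyFlat.iff_flat_and_comap_surjective.2 ⟨?_, fun q => ?_⟩⟩
    · change F p * (show ∀ i, B i from x) = 0 at hx
      rw [map_natCast] at hx
      funext i
      exact (hB i).torsionFree _ (congrFun hx i)
    · let := (mapModP p F).toAlgebra
      exact hA.isPBool.flat _
    · obtain ⟨x, rfl⟩ := (toSpec_bijective hA).2 q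
      obtain ⟨i, y, rfl⟩ := hsurj x
      exact ⟨_, hcomap i y⟩

end

/-! ### Countable presentations -/

/-- An ideal in a polynomial ring in countably many variables over a Noetherian ring is countably
generated. -/
theorem exists_countable_span_eq {k : Type} [CommRing k] [IsNoetherianRing k]
    (I : Ideal (MvPolynomial ℕ k)) :
    ∃ S : Set (MvPolynomial ℕ k), S.Countable ∧ I = Ideal.span S := by
  -- The polynomial ring is a countable union of images of Noetherian polynomial rings in finitely
  -- many variables; generators are collected from each.
  obtain ⟨φ, hφ⟩ : ∃ φ : ∀ x : Σ n, Fin n → ℕ, MvPolynomial (Fin x.1) k →+* MvPolynomial ℕ k,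
      ∀ q, ∃ x r, φ x r = q := by
    refine ⟨fun x => (MvPolynomial.rename x.2).toRingHom, fun q => ?_⟩
    obtain ⟨n, f, -, r, hr⟩ := MvPolynomial.exists_fin_rename q
    exact ⟨⟨n, f⟩, r, hr.symm⟩
  have hfg : ∀ x, (I.comap (φ x)).FG := fun x => (isNoetherianRing_iff_ideal_fg _).1 inferInstance _
  choose T hT using hfg
  refine ⟨⋃ x, φ x '' T x, Set.countable_iUnion fun x => (T x).countable_toSet.image _,
    le_antisymm (fun q hq => ?_) ?_⟩
  · obtain ⟨x, r, rfl⟩ := hφ q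
    have h1 : r ∈ Ideal.span (T x : Set (MvPolynomial (Fin x.1) k)) := (hT x).ge hq
    have h2 := Ideal.mem_map_of_mem (φ x) h1
    rw [Ideal.map_span] at h2
    exact Ideal.span_mono (Set.subset_iUnion_of_subset x subset_rfl) h2
  · rw [Ideal.span_le]
    refine Set.iUnion_subset fun x => ?_
    rintro _ ⟨r, hr, rfl⟩
    exact (hT x).le (Ideal.subset_span hr)

/-- The condition on `A / p` that amounts to `A` being countably presented. -/
def IsSmallRing : PresentationSense → Type → Prop
  | .algebraic => fun R => Finite R
  | .pComplete => fun R => Countable R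

section

variable {p : ℕ} [hp : Fact p.Prime] {R : Type} [CommRing R]

/-- In general the factor is `r ^ (p ^ k)`, which is `r` here. The induction splits off the zeroth
coefficient, `w = [w₀] + V(w')`, and uses that `V = p` commutes with multiplication by `[r]`. -/
theorem IsPBool.teichmuller_mul_coeff (h : IsPBool p R) (r : R) (k : ℕ) (w : WittVector p R) :
    (WittVector.teichmuller p r * w).coeff k = r * w.coeff k := by
  have hw : ∀ w : WittVector p R,
      w = WittVector.teichmuller p (w.coeff 0) + WittVector.verschiebung (w.shift 1) := by
    intro w
    ext n
    rw [WittVector.coeff_add_of_disjoint]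
    · rcases n with _ | n
      · simp [WittVector.verschiebung_coeff_zero]
      · rw [WittVector.verschiebung_coeff_succ, WittVector.teichmuller_coeff_pos _ _ _ n.succ_pos,
          zero_add, WittVector.shift_coeff, add_comm]
    · rintro (_ | n)
      · exact Or.inr (WittVector.verschiebung_coeff_zero _)
      · exact Or.inl (WittVector.teichmuller_coeff_pos _ _ _ n.succ_pos)
  induction k generalizing w with
  | zero => rw [WittVector.mul_coeff_zero, WittVector.teichmuller_coeff_zero]
  | succ k ih =>
    conv_lhs => rw [hw w]
    have : WittVector.teichmuller p r * (WittVector.teichmuller p (w.coeff 0) +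
        WittVector.verschiebung (w.shift 1)) = WittVector.teichmuller p (r * w.coeff 0) +
        WittVector.verschiebung (WittVector.teichmuller p r * w.shift 1) := by
      rw [h.verschiebung_eq, h.verschiebung_eq, map_mul]
      ring
    rw [this, WittVector.coeff_add_of_disjoint]
    · rw [WittVector.verschiebung_coeff_succ, WittVector.teichmuller_coeff_pos _ _ _ k.succ_pos,
        zero_add, ih, WittVector.shift_coeff, add_comm]
    · rintro (_ | n)
      · exact Or.inr (WittVector.verschiebung_coeff_zero _)
      · exact Or.inl (WittVector.teichmuller_coeff_pos _ _ _ n.succ_pos)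

/-- If `R` is finite, then `W(R)` is spanned over `ℤ_p` by the Teichmüller lifts. -/
theorem IsPBool.eq_sum_teichmuller (h : IsPBool p R) [Fintype R] (x : WittVector p R) :
    ∃ z : R → WittVector p (ZMod p),
      x = ∑ r, WittVector.teichmuller p r * WittVector.map h.ofZMod (z r) := by
  classical
  -- `z r` marks by `1` the positions where `x` has coefficient `r`. At each position at most one
  -- summand is nonzero, so the Witt vector sum is coefficientwise.
  refine ⟨fun r => WittVector.mk p fun k => if x.coeff k = r then 1 else 0, ?_⟩
  have hc : ∀ (r : R) (k : ℕ), (WittVector.teichmuller p r * WittVector.map h.ofZMod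
      (WittVector.mk p fun k => if x.coeff k = r then 1 else 0)).coeff k =
        if x.coeff k = r then r else 0 := by
    intro r k
    rw [h.teichmuller_mul_coeff, WittVector.map_coeff, WittVector.coeff_mk]
    split_ifs <;> simp
  ext k
  rw [WittVector.sum_coeff_eq_coeff_sum]
  · simp only [hc]
    simp
  · intro n
    refine ⟨fun a b => Subtype.ext ?_⟩
    obtain ⟨a, -, ha⟩ := a
    obtain ⟨b, -, hb⟩ := b
    rw [hc] at ha hb
    have h1 : x.coeff n = a := by
      by_contra h'
      exact ha (if_neg h')
    have h2 : x.coeff n = b := by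
      by_contra h'
      exact hb (if_neg h')
    exact h1.symm.trans h2

theorem hasCountablePresentation_of_finite {A : Type} [CommRing A] (h : IsPBool p R) [Finite R]
    (e : A ≃+* WittVector p R) : HasCountablePresentation ℤ_[p] A := by
  have := Fintype.ofFinite R
  obtain ⟨r, hr⟩ := exists_surjective_nat R
  let c : ℤ_[p] →+* WittVector p R :=
    (WittVector.map h.ofZMod).comp ((WittVector.equiv p).symm : ℤ_[p] →+* WittVector p (ZMod p))
  let g : MvPolynomial ℕ ℤ_[p] →+* WittVector p R :=
    MvPolynomial.eval₂Hom c fun n => WittVector.teichmuller p (r n)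
  have hg : Function.Surjective g := by
    intro x
    obtain ⟨z, hz⟩ := h.eq_sum_teichmuller x
    choose i hi using hr
    refine ⟨∑ s, MvPolynomial.X (i s) * MvPolynomial.C (WittVector.equiv p (z s)), ?_⟩
    rw [map_sum, hz]
    refine Finset.sum_congr rfl fun s _ => ?_
    simp [g, c, hi]
  refine ⟨(e.symm : WittVector p R →+* A).comp g, e.symm.surjective.comp hg, ?_⟩
  exact exists_countable_span_eq _

theorem hasCountablePresentation_of_countable (h : IsPBool p R) [Countable R] :
    HasCountablePresentation (ZMod p) R := by
  obtain ⟨r, hr⟩ := exists_surjective_nat R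
  refine ⟨MvPolynomial.eval₂Hom h.ofZMod r, fun x => ?_, exists_countable_span_eq _⟩
  obtain ⟨n, rfl⟩ := hr x
  exact ⟨MvPolynomial.X n, by simp⟩

/-- Coefficient `k` depends only on the sum modulo `p ^ (k + 1)`, so each `z j` matters only through
its residue, one of `p ^ (k + 1)` values. -/
theorem IsPBool.finite_coeff (h : IsPBool p R) (c : ℤ_[p] →+* WittVector p R)
    (w : ℕ → WittVector p R) (n k : ℕ) :
    {r : R | ∃ z : ℕ → ℤ_[p], (∑ j ∈ Finset.range n, c (z j) * w j).coeff k = r}.Finite := by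
  refine (Set.finite_range fun t : Fin n → Fin (p ^ (k + 1)) =>
    (∑ j : Fin n, ((t j : ℕ) : WittVector p R) * w j).coeff k).subset ?_
  rintro _ ⟨z, rfl⟩
  refine ⟨fun j => ⟨(z j).appr (k + 1), (z j).appr_lt (k + 1)⟩, ?_⟩
  have htr : WittVector.truncate (k + 1) (∑ j ∈ Finset.range n, c (z j) * w j) =
      WittVector.truncate (k + 1)
        (∑ j : Fin n, (((z j).appr (k + 1) : ℕ) : WittVector p R) * w j) := by
    rw [Finset.sum_range, map_sum, map_sum]
    refine Finset.sum_congr rfl fun j _ => ?_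
    obtain ⟨y, hy⟩ := Ideal.mem_span_singleton.1 ((z j).appr_spec (k + 1))
    rw [← sub_eq_zero, ← map_sub, ← sub_mul]
    have h1 : c (z j) - ((z j).appr (k + 1) : WittVector p R) = p ^ (k + 1) * c y := by
      rw [← map_natCast c, ← map_sub, hy, map_mul, map_pow, map_natCast]
    rw [h1, mul_assoc, h.pow_mul_eq, ← RingHom.mem_ker, WittVector.mem_ker_truncate]
    exact fun i hi => WittVector.iterate_verschiebung_coeff_eq_zero _ hi
  have := congrArg (TruncatedWittVector.coeff (Fin.last k)) htr
  rw [WittVector.coeff_truncate, WittVector.coeff_truncate] at this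
  exact this.symm

/-- A diagonal argument using only countable generation. Enumerate the images of the monomials; for
infinite `R`, choose `x k` outside the finite set of `k`-th coefficients of combinations of the
first `k` of them. The Witt vector with coefficients `x` is then no finite combination. -/
theorem IsPBool.finite_of_hasCountablePresentation {A : Type} [CommRing A] (h : IsPBool p R)
    (e : A ≃+* WittVector p R) (hA : HasCountablePresentation ℤ_[p] A) : Finite R := by
  obtain ⟨f, hf, -⟩ := hA
  by_contra hfin
  have hinf : Infinite R := not_finite_iff_infinite.1 hfin
  let g : MvPolynomial ℕ ℤ_[p] →+* WittVector p R := (e : A →+* WittVector p R).comp f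
  have hg : Function.Surjective g := e.surjective.comp hf
  let c : ℤ_[p] →+* WittVector p R := g.comp MvPolynomial.C
  obtain ⟨m⟩ : Nonempty (ℕ ≃ (ℕ →₀ ℕ)) := nonempty_equiv_of_countable
  let w : ℕ → WittVector p R := fun j => g (MvPolynomial.monomial (m j) 1)
  choose x hx using fun k => (h.finite_coeff c w k k).exists_notMem
  obtain ⟨q, hq⟩ := hg (WittVector.mk p x)
  obtain ⟨n, hn⟩ := (q.support.image m.symm).exists_nat_subset_range
  refine hx n ⟨fun j => q.coeff (m j), ?_⟩
  have hsum : ∑ j ∈ Finset.range n, c (q.coeff (m j)) * w j = g q := by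
    conv_rhs => rw [q.as_sum, map_sum]
    have h1 : ∑ v ∈ q.support, g (MvPolynomial.monomial v (q.coeff v)) =
        ∑ j ∈ q.support.image m.symm, c (q.coeff (m j)) * w j := by
      rw [Finset.sum_image m.symm.injective.injOn]
      refine Finset.sum_congr rfl fun v _ => ?_
      simp only [c, w, RingHom.comp_apply, ← map_mul, MvPolynomial.C_mul_monomial, mul_one,
        Equiv.apply_symm_apply]
    rw [h1]
    refine (Finset.sum_subset hn fun j _ hj => ?_).symm
    have : q.coeff (m j) = 0 := by
      by_contra h0
      exact hj (Finset.mem_image.2 ⟨m j, MvPolynomial.mem_support_iff.2 h0, m.symm_apply_apply j⟩)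
    rw [this, map_zero, zero_mul]
  rw [hsum, hq, WittVector.coeff_mk]

theorem isCountablyPresented_iff {s : PresentationSense} {A : DeltaRingCat p}
    (hA : StoneRing p A) : IsCountablyPresented p s A ↔ IsSmallRing s (ModP p A) := by
  obtain ⟨e, -⟩ := hA.exists_equiv
  cases s with
  | algebraic =>
    exact ⟨hA.isPBool.finite_of_hasCountablePresentation e, fun h =>
      have : Finite (ModP p A) := h
      hasCountablePresentation_of_finite hA.isPBool e⟩
  | pComplete =>
    exact ⟨countable_modP p .pComplete A, fun h =>
      have : Countable (ModP p A) := h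
      hasCountablePresentation_of_countable hA.isPBool⟩

end

section

variable {p : ℕ} [hp : Fact p.Prime]

/-! ### Reduction modulo p as a fully faithful functor -/

theorem IsSmallRing.of_surjective {s : PresentationSense} {R S : Type} (h : IsSmallRing s R)
    (f : R → S) (hf : Function.Surjective f) : IsSmallRing s S := by
  cases s with
  | algebraic =>
    have : Finite R := h
    exact Finite.of_surjective f hf
  | pComplete =>
    have : Countable R := h
    exact hf.countable

/-- A ring isomorphism between Stone `δ`-rings is an isomorphism of `δ`-rings. -/
def isoOfRingEquiv {A B : DeltaRingCat p} (hA : StoneRing p A) (hB : StoneRing p B) (e : A ≃+* B) :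
    A ≅ B where
  hom := hA.deltaHom hB e
  inv := hB.deltaHom hA e.symm
  hom_inv_id := DeltaHom.ext (RingHom.ext e.symm_apply_apply)
  inv_hom_id := DeltaHom.ext (RingHom.ext e.apply_symm_apply)

theorem StoneRing.isStone {A : DeltaRingCat p} (hA : StoneRing p A) : IsStone p A := by
  obtain ⟨e, -⟩ := hA.exists_equiv
  exact ⟨hA.isPBool.toPBoolean,
    ⟨isoOfRingEquiv hA (PBoolean.witt_stoneRing hA.isPBool.toPBoolean) e⟩⟩

variable {s : PresentationSense}

theorem CountableStone.stoneRing (A : CountableStone p s) : StoneRing p A.obj :=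
  A.property.1.stoneRing

theorem CountableStone.isSmallRing (A : CountableStone p s) : IsSmallRing s (ModP p A.obj) :=
  (isCountablyPresented_iff A.stoneRing).1 A.property.2

/-- A Stone `δ`-ring with small reduction, as an object of the category. -/
def StoneRing.toCountableStone {A : DeltaRingCat p} (hA : StoneRing p A)
    (hs : IsSmallRing s (ModP p A)) : CountableStone p s :=
  ⟨A, hA.isStone, (isCountablyPresented_iff hA).2 hs⟩

variable (p s) in
/-- Reduction modulo `p`. -/
def reduction : CountableStone p s ⥤ CommRingCat.{0} where
  obj A := CommRingCat.of (ModP p A.obj)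
  map f := CommRingCat.ofHom (mapModP p (DeltaHom.toRingHom f.hom))
  map_id A := by
    ext
    rfl
  map_comp f g := by
    ext
    rfl

instance : (reduction p s).Faithful where
  map_injective {A B f g} h := by
    refine InducedCategory.hom_ext (DeltaHom.ext ?_)
    exact A.stoneRing.ringHom_ext B.stoneRing _ _ (congrArg CommRingCat.Hom.hom h)

instance : (reduction p s).Full where
  map_surjective {A B} h := by
    obtain ⟨f, hf⟩ := A.stoneRing.exists_lift B.stoneRing h.hom
    exact ⟨ObjectProperty.homMk (A.stoneRing.deltaHom B.stoneRing f), CommRingCat.hom_ext hf⟩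

/-- Essential image of `reduction`; constructions with small `p`-Boolean rings lift along it to
Stone `δ`-rings. -/
theorem exists_reduction_iso {R : Type} [CommRing R] (h : IsPBool p R) (hs : IsSmallRing s R) :
    ∃ A : CountableStone p s, Nonempty ((reduction p s).obj A ≅ CommRingCat.of R) := by
  let e : ModP p h.toPBoolean.witt ≃+* R := modPEquiv h (RingEquiv.refl _)
  exact ⟨(PBoolean.witt_stoneRing h.toPBoolean).toCountableStone
    (hs.of_surjective e.symm e.symm.surjective), ⟨e.toCommRingCatIso⟩⟩

/-! ### Finite limits -/

open scoped TensorProduct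

theorem IsPBool.tensorProduct {R S T : Type} [CommRing R] [CommRing S] [CommRing T]
    [Algebra R S] [Algebra R T] (hS : IsPBool p S) (hT : IsPBool p T) :
    IsPBool p (S ⊗[R] T) := by
  have h0 : (p : S ⊗[R] T) = 0 := by
    rw [← map_natCast (algebraMap S (S ⊗[R] T)), hS.cast_eq_zero, map_zero]
  refine ⟨h0, fun a => ?_⟩
  induction a using TensorProduct.induction_on with
  | zero => exact zero_pow hp.out.ne_zero
  | tmul x y => rw [Algebra.TensorProduct.tmul_pow, hS.pow_eq, hT.pow_eq]
  | add x y hx hy => rw [add_pow_prime, h0, zero_mul, add_zero, hx, hy]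

theorem IsSmallRing.tensorProduct {R S T : Type} [CommRing R] [CommRing S] [CommRing T]
    [Algebra R S] [Algebra R T] (hS : IsSmallRing s S) (hT : IsSmallRing s T) :
    IsSmallRing s (S ⊗[R] T) := by
  cases s with
  | algebraic =>
    have : Finite S := hS
    have : Finite T := hT
    have : Module.Finite R T := Module.Finite.of_finite
    exact Module.finite_of_finite S
  | pComplete =>
    have : Countable S := hS
    have : Countable T := hT
    have : Countable (FreeAddMonoid (S × T)) := inferInstanceAs (Countable (List (S × T)))
    exact (AddCon.mk'_surjective (c := addConGen (TensorProduct.Eqv R S T))).countable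

/-- The tensor product of the reductions is again `p`-Boolean and small, hence a reduction, and a
fully faithful functor reflects pushouts. -/
instance : HasPushouts (CountableStone p s) := by
  refine @hasPushouts_of_hasColimit_span _ _ fun {A B C f g} => ?_
  let f' := mapModP p (DeltaHom.toRingHom f.hom)
  let g' := mapModP p (DeltaHom.toRingHom g.hom)
  let := f'.toAlgebra
  let := g'.toAlgebra
  obtain ⟨D, ⟨e⟩⟩ := exists_reduction_iso
    (B.stoneRing.isPBool.tensorProduct (R := ModP p A.obj) C.stoneRing.isPBool)
    (B.isSmallRing.tensorProduct (R := ModP p A.obj) C.isSmallRing)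
  have h := CommRingCat.isPushout_tensorProduct (ModP p A.obj) (ModP p B.obj) (ModP p C.obj)
  have h' : IsPushout ((reduction p s).map f) ((reduction p s).map g)
      ((reduction p s).map ((reduction p s).preimage (CommRingCat.ofHom
        Algebra.TensorProduct.includeLeftRingHom ≫ e.inv)))
      ((reduction p s).map ((reduction p s).preimage (CommRingCat.ofHom
        Algebra.TensorProduct.includeRight.toRingHom ≫ e.inv))) := by
    refine h.of_iso (Iso.refl _) (Iso.refl _) (Iso.refl _) e.symm ?_ ?_ ?_ ?_
    · exact (Category.comp_id _).trans (Category.id_comp _).symm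
    · exact (Category.comp_id _).trans (Category.id_comp _).symm
    · rw [Functor.map_preimage]
      exact (Category.id_comp _).symm
    · rw [Functor.map_preimage]
      exact (Category.id_comp _).symm
  exact (IsPushout.of_map (reduction p s)
    ((reduction p s).map_injective (by simpa using h'.w)) h').hasPushout

variable (p s) in
/-- The ring `ℤ_p` as a countably presented Stone `δ`-ring. -/
def padicIntObj : CountableStone p s :=
  StoneRing.toCountableStone (A := ⟨ℤ_[p]⟩) (padicInt_stoneRing p) (by
    have h : IsSmallRing s (ZMod p) := by
      cases s with
      | algebraic => exact inferInstanceAs (Finite (ZMod p))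
      | pComplete => exact inferInstanceAs (Countable (ZMod p))
    exact h.of_surjective _ (modPPadicInt p).symm.surjective)

/-- Through `reduction` this is the initiality of `𝔽_p` among `p`-Boolean rings. -/
instance : HasInitial (CountableStone p s) := by
  have h : ∀ A : CountableStone p s, Nonempty (padicIntObj p s ⟶ A) := fun A =>
    ⟨(reduction p s).preimage (CommRingCat.ofHom (A.stoneRing.isPBool.ofZMod.comp
      (modPPadicInt p : ModP p ℤ_[p] →+* ZMod p)))⟩
  have h' : ∀ A : CountableStone p s, Subsingleton (padicIntObj p s ⟶ A) := fun A => by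
    refine ⟨fun f g => (reduction p s).map_injective (CommRingCat.hom_ext ?_)⟩
    have := Subsingleton.elim
      (((reduction p s).map f).hom.comp ((modPPadicInt p).symm : ZMod p →+* ModP p ℤ_[p]))
      (((reduction p s).map g).hom.comp ((modPPadicInt p).symm : ZMod p →+* ModP p ℤ_[p]))
    refine RingHom.ext fun a => ?_
    obtain ⟨b, rfl⟩ := (modPPadicInt p).symm.surjective a
    exact RingHom.congr_fun this b
  have : ∀ A : CountableStone p s, Unique (padicIntObj p s ⟶ A) := fun A =>
    @Unique.mk' _ ⟨(h A).some⟩ (h' A)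
  exact hasInitial_of_unique (padicIntObj p s)

instance : HasFiniteLimits (TD p s) :=
  hasFiniteLimits_of_hasTerminal_and_pullbacks

/-- The points of `A` are the homomorphisms to `ℤ_p`. -/
def uForgetIso : u p s ⋙ forget LightProfinite.{0} ≅ coyoneda.obj (op (op (padicIntObj p s))) :=
  NatIso.ofComponents (fun _ => Equiv.toIso
    { toFun := fun f => Quiver.Hom.op (ObjectProperty.homMk f)
      invFun := fun g => g.unop.hom
      left_inv := fun _ => rfl
      right_inv := fun _ => rfl }) (fun _ => rfl)

instance (J : Type) [SmallCategory J] [FinCategory J] :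
    PreservesLimitsOfShape J (forget LightProfinite.{0}) :=
  inferInstanceAs (PreservesLimitsOfShape J (lightToProfinite ⋙ forget Profinite.{0}))

/-- The underlying set functor of `u` is corepresentable, and `forget` on light profinite sets
reflects finite limits, as it preserves them and reflects isomorphisms. -/
instance : PreservesFiniteLimits (u p s) := by
  refine ⟨fun J _ _ => ?_⟩
  have := reflectsLimitsOfShape_of_reflectsIsomorphisms (G := forget LightProfinite.{0}) (J := J)
  have : PreservesLimitsOfShape J (u p s ⋙ forget LightProfinite.{0}) :=
    preservesLimitsOfShape_of_natIso uForgetIso.symm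
  exact preservesLimitsOfShape_of_reflects_of_preserves (u p s) (forget LightProfinite.{0})

end

section

variable {p : ℕ} [hp : Fact p.Prime] {s : PresentationSense}

/-! ### The site of countably presented Stone delta-rings -/

theorem exists_points_iff {A B : TD p s} (f : B ⟶ A) (x : op (padicIntObj p s) ⟶ A) :
    (∃ y : Points p B.unop.obj, precomp f.unop.hom y = x.unop.hom) ↔
      ∃ y : op (padicIntObj p s) ⟶ B, y ≫ f = x :=
  ⟨fun ⟨y, hy⟩ => ⟨Quiver.Hom.op (ObjectProperty.homMk y),
      Quiver.Hom.unop_inj (InducedCategory.hom_ext hy)⟩,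
    fun ⟨y, hy⟩ => ⟨y.unop.hom, congrArg (fun z => z.unop.hom) hy⟩⟩

/-- Phrased with maps from the terminal object, coverings satisfy the pretopology axioms formally.
-/
theorem mem_tdCoverings_iff {A : TD p s} {R : Presieve A} :
    R ∈ tdCoverings p s A ↔ ∃ (n : ℕ) (B : Fin n → TD p s) (f : ∀ i, B i ⟶ A),
      R = Presieve.ofArrows B f ∧ ∀ x : op (padicIntObj p s) ⟶ A,
        ∃ (i : Fin n) (y : op (padicIntObj p s) ⟶ B i), y ≫ f i = x := by
  refine exists_congr fun n => exists_congr fun B => exists_congr fun f => and_congr_right fun _ =>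
    (isPCompletelyFaithfullyFlat_pi_iff (fun i => (f i).unop.hom) A.unop.stoneRing
      fun i => (B i).unop.stoneRing).trans ?_
  constructor
  · intro h x
    obtain ⟨i, hi⟩ := h x.unop.hom
    exact ⟨i, (exists_points_iff (f i) x).1 hi⟩
  · intro h x
    obtain ⟨i, hi⟩ := h (Quiver.Hom.op (ObjectProperty.homMk x))
    exact ⟨i, (exists_points_iff (f i) _).2 hi⟩

theorem ofArrows_mem_tdCoverings {A : TD p s} {ι : Type} [Finite ι] (B : ι → TD p s)
    (f : ∀ i, B i ⟶ A) (h : ∀ x : op (padicIntObj p s) ⟶ A,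
      ∃ (i : ι) (y : op (padicIntObj p s) ⟶ B i), y ≫ f i = x) :
    Presieve.ofArrows B f ∈ tdCoverings p s A := by
  obtain ⟨n, ⟨e⟩⟩ := Finite.exists_equiv_fin ι
  refine mem_tdCoverings_iff.2 ⟨n, B ∘ e.symm, fun i => f (e.symm i),
    (Presieve.ofArrows_comp_eq_of_surjective f e.symm.surjective).symm, fun x => ?_⟩
  obtain ⟨i, y, hy⟩ := h x
  obtain ⟨i, rfl⟩ := e.symm.surjective i
  exact ⟨i, y, hy⟩

variable (p s) in
/-- The coverings of `TD` form a pretopology. -/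
def tdPretopology : Pretopology (TD p s) where
  toPrecoverage := tdCoverings p s
  has_isos X Y f _ := by
    rw [← Presieve.ofArrows_pUnit.{0}]
    exact ofArrows_mem_tdCoverings _ _ fun x => ⟨PUnit.unit, x ≫ inv f, by simp⟩
  pullbacks X Y g R hR := by
    obtain ⟨n, B, f, rfl, h⟩ := mem_tdCoverings_iff.1 hR
    rw [← Presieve.ofArrows_pullback]
    refine ofArrows_mem_tdCoverings _ _ fun x => ?_
    obtain ⟨i, y, hy⟩ := h (x ≫ g)
    exact ⟨i, pullback.lift y x hy, pullback.lift_snd _ _ _⟩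
  transitive X R T hR hT := by
    obtain ⟨n, B, f, rfl, h⟩ := mem_tdCoverings_iff.1 hR
    choose m C g hg h' using fun i => mem_tdCoverings_iff.1 (hT (f i) ⟨i⟩)
    have : (Presieve.ofArrows B f).bind T =
        Presieve.ofArrows (fun ij : Σ i, Fin (m i) => C ij.1 ij.2)
          (fun ij => g ij.1 ij.2 ≫ f ij.1) := by
      apply le_antisymm
      · rintro Z _ ⟨Y, v, _, ⟨i⟩, hv, rfl⟩
        rw [hg] at hv
        obtain ⟨j⟩ := hv
        exact Presieve.ofArrows.mk (⟨i, j⟩ : Σ i, Fin (m i))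
      · rintro Z _ ⟨ij⟩
        refine ⟨_, g ij.1 ij.2, f ij.1, ⟨ij.1⟩, ?_, rfl⟩
        rw [hg]
        exact ⟨ij.2⟩
    rw [this]
    refine ofArrows_mem_tdCoverings _ _ fun x => ?_
    obtain ⟨i, y, rfl⟩ := h x
    obtain ⟨j, z, rfl⟩ := h' i y
    exact ⟨⟨i, j⟩, z, (Category.assoc _ _ _).symm⟩

theorem isSite_tdCoverings : IsSite (tdCoverings p s) :=
  ⟨inferInstance, tdPretopology p s, rfl⟩

theorem map_mem_lightCoverings {A : TD p s} {R : Presieve A} (hR : R ∈ tdCoverings p s A) :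
    R.map (u p s) ∈ lightCoverings ((u p s).obj A) := by
  obtain ⟨n, B, f, rfl, h⟩ := mem_tdCoverings_iff.1 hR
  refine ⟨n, fun i => (u p s).obj (B i), fun i => (u p s).map (f i), Presieve.map_ofArrows _,
    fun x => ?_⟩
  obtain ⟨i, hi⟩ := h (Quiver.Hom.op (ObjectProperty.homMk x))
  exact ⟨i, (exists_points_iff (f i) _).2 hi⟩

theorem isContinuousFunctor_u : IsContinuousFunctor (tdCoverings p s) lightCoverings (u p s) where
  map_covering _ _ := map_mem_lightCoverings
  hasPullback _ _ _ _ _ _ _ _ := inferInstance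
  map_isPullback _ _ _ _ _ _ _ _ _ _ _ h := h.map (u p s)

/-! ### Continuity for the Grothendieck topologies -/

/-- A finite family is effective epimorphic exactly when the map from its coproduct is, and for
light profinite sets this means surjective. -/
theorem generate_mem_coherentTopology {S : LightProfinite.{0}} {R : Presieve S}
    (hR : R ∈ lightCoverings S) : Sieve.generate R ∈ coherentTopology LightProfinite.{0} S := by
  obtain ⟨n, T, f, rfl, h⟩ := hR
  rw [coherentTopology.mem_sieves_iff_hasEffectiveEpiFamily]
  refine ⟨Fin n, inferInstance, T, f, ?_, fun i => Sieve.le_generate _ _ _ ⟨i⟩⟩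
  rw [← effectiveEpi_desc_iff_effectiveEpiFamily, LightProfinite.effectiveEpi_iff_surjective]
  intro x
  obtain ⟨i, y, hy⟩ := h x
  refine ⟨Sigma.ι T i y, ?_⟩
  rw [← hy, ← ConcreteCategory.comp_apply, Sigma.ι_desc]

theorem coverPreserving_u :
    CoverPreserving (tdCoverings p s).toGrothendieck (coherentTopology LightProfinite.{0})
      (u p s) where
  cover_preserve {A S} hS := by
    -- Because the coverings form a pretopology, every covering sieve contains an actual covering
    -- family.
    have hle : (tdCoverings p s).toGrothendieck ≤ (tdPretopology p s).toGrothendieck := by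
      rw [Precoverage.toGrothendieck_le_iff_le_toPrecoverage]
      exact fun A R hR => ⟨R, hR, Sieve.le_generate R⟩
    obtain ⟨R, hR, hRS⟩ := hle _ hS
    refine (coherentTopology LightProfinite.{0}).superset_covering ?_
      (generate_mem_coherentTopology (map_mem_lightCoverings hR))
    rw [Sieve.generate_map_eq_functorPushforward]
    exact Sieve.functorPushforward_monotone _ _ ((Sieve.generate_le_iff _ _).2 hRS)

instance : RepresentablyFlat (u p s) := flat_of_preservesFiniteLimits _

instance isContinuous_u :
    (u p s).IsContinuous (tdCoverings p s).toGrothendieck (coherentTopology LightProfinite.{0}) :=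
  Functor.isContinuous_of_coverPreserving (compatiblePreservingOfFlat _ _) coverPreserving_u

/-! ### Essential smallness -/

/-- `A` is determined up to isomorphism by `A / p`, a countable ring, hence a quotient of `ℤ[x₀, x₁,
…]`; the ideals of that ring form a small set. -/
instance : EssentiallySmall.{0} (CountableStone p s) := by
  rw [essentiallySmall_iff]
  refine ⟨?_, inferInstance⟩
  let X := {I : Ideal (MvPolynomial ℕ ℤ) // IsPBool p (MvPolynomial ℕ ℤ ⧸ I) ∧
    IsSmallRing s (MvPolynomial ℕ ℤ ⧸ I)}
  let F : X → Skeleton (CountableStone p s) := fun I =>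
    toSkeleton (exists_reduction_iso I.2.1 I.2.2).choose
  refine small_of_surjective (f := F) fun A => ?_
  obtain ⟨A, rfl⟩ : ∃ B, toSkeleton B = A := Quotient.exists_rep A
  have : Countable (ModP p A.obj) := countable_modP p s A.obj A.property.2
  obtain ⟨r, hr⟩ := exists_surjective_nat (ModP p A.obj)
  let g : MvPolynomial ℕ ℤ →+* ModP p A.obj := MvPolynomial.eval₂Hom (Int.castRingHom _) r
  have hg : Function.Surjective g := fun a => by
    obtain ⟨n, rfl⟩ := hr a
    exact ⟨MvPolynomial.X n, by simp [g]⟩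
  let e := RingHom.quotientKerEquivOfSurjective hg
  let I : X := ⟨RingHom.ker g, A.stoneRing.isPBool.of_surjective e.symm e.symm.surjective,
    A.isSmallRing.of_surjective e.symm e.symm.surjective⟩
  refine ⟨I, ?_⟩
  obtain ⟨i⟩ := (exists_reduction_iso I.2.1 I.2.2).choose_spec
  exact Quotient.sound ⟨(reduction p s).preimageIso (i ≪≫ e.toCommRingCatIso)⟩

end

/-! ### Left Kan extensions along flat functors -/

section

variable {C D : Type 1} [Category.{0} C] [Category.{0} D]

theorem comp_comp_eq_of_squares {V₁ V₂ V₃ W₁ W₂ W₃ Z : C} {a : V₁ ⟶ V₂} {m : V₂ ⟶ V₃}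
    {f : V₁ ⟶ W₁} {a' : W₁ ⟶ W₂} {m' : W₂ ⟶ W₃} {g : V₂ ⟶ W₂} {h : V₃ ⟶ W₃}
    (h₁ : a ≫ g = f ≫ a') (h₂ : m ≫ h = g ≫ m') (k : W₃ ⟶ Z) :
    (a ≫ m) ≫ h ≫ k = f ≫ (a' ≫ m') ≫ k := by
  rw [Category.assoc, reassoc_of% h₂, reassoc_of% h₁, Category.assoc]

/-- The evaluation of a left Kan extension at `X` is a colimit over the costructured arrows
over `X`. -/
def lanEvaluationIso (F : C ⥤ D) (X : D)
    [∀ X : D, HasColimitsOfShape (CostructuredArrow F X) Type] :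
    F.lan ⋙ (evaluation D Type).obj X ≅
      (Functor.whiskeringLeft _ _ Type).obj (CostructuredArrow.proj F X) ⋙ colim :=
  NatIso.ofComponents (fun G =>
    IsColimit.coconePointUniqueUpToIso
      (Functor.isPointwiseLeftKanExtensionLeftKanExtensionUnit F G X)
      (colimit.isColimit (CostructuredArrow.proj F X ⋙ G))) (fun {G₁ G₂} φ => by
    apply (Functor.isPointwiseLeftKanExtensionLeftKanExtensionUnit F G₁ X).hom_ext
    intro T
    have h₁ := fun G : C ⥤ Type => IsColimit.comp_coconePointUniqueUpToIso_hom
      (Functor.isPointwiseLeftKanExtensionLeftKanExtensionUnit F G X)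
      (colimit.isColimit (CostructuredArrow.proj F X ⋙ G)) T
    have h₂ : (F.leftKanExtensionUnit G₁).app T.left ≫ (F.lan.map φ).app (F.obj T.left) =
      φ.app T.left ≫ (F.leftKanExtensionUnit G₂).app T.left :=
      (congr_app (F.lanUnit.naturality φ) T.left).symm
    have h₃ : (F.leftKanExtension G₁).map T.hom ≫ (F.lan.map φ).app X =
      (F.lan.map φ).app (F.obj T.left) ≫ (F.leftKanExtension G₂).map T.hom :=
      (F.lan.map φ).naturality T.hom
    have h₄ : colimit.ι (CostructuredArrow.proj F X ⋙ G₁) T ≫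
        colim.map (Functor.whiskerLeft (CostructuredArrow.proj F X) φ) =
      φ.app T.left ≫ colimit.ι (CostructuredArrow.proj F X ⋙ G₂) T := ι_colimMap _ _
    -- On the leg at `T`, both composites are `φ` followed by the colimit injection.
    refine Eq.trans (b := φ.app T.left ≫ colimit.ι (CostructuredArrow.proj F X ⋙ G₂) T) ?_ ?_
    · refine Eq.trans ?_ (congrArg (fun t => φ.app T.left ≫ t) (h₁ G₂))
      exact comp_comp_eq_of_squares h₂ h₃ _
    · refine h₄.symm.trans ((congrArg (fun t => t ≫ colim.map
        (Functor.whiskerLeft (CostructuredArrow.proj F X) φ)) (h₁ G₁)).symm.trans ?_)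
      exact Category.assoc _ _ _)

/-- Finite limits commute with small filtered colimits of sets; `J` has its objects in `Type 1`, so
the colimit is moved to a small model. -/
theorem preservesFiniteLimits_colim (J : Type 1) [Category.{0} J] [EssentiallySmall.{0} J]
    [IsFiltered J] [HasColimitsOfShape J Type] :
    PreservesFiniteLimits (colim : (J ⥤ Type) ⥤ Type) := by
  have : IsFiltered (SmallModel.{0} J) := IsFiltered.of_equivalence (equivSmallModel.{0} J)
  have : PreservesFiniteLimits (((Functor.whiskeringLeft _ _ Type).obj
      (equivSmallModel.{0} J).inverse) ⋙ colim) := comp_preservesFiniteLimits _ _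
  exact preservesFiniteLimits_of_natIso (Functor.Final.colimIso (equivSmallModel.{0} J).inverse)

/-- Limits of presheaves are pointwise, and flatness of `F` makes the indexing categories of the
pointwise colimits filtered. -/
theorem preservesFiniteLimits_lan [EssentiallySmall.{0} C] (F : C ⥤ D) [RepresentablyFlat F]
    [∀ X, HasColimitsOfShape (CostructuredArrow F.op X) Type] :
    PreservesFiniteLimits (F.op.lan : (Cᵒᵖ ⥤ Type) ⥤ Dᵒᵖ ⥤ Type) := by
  refine ⟨fun J _ _ => ?_⟩
  apply preservesLimitsOfShape_of_evaluation (F.op.lan : (Cᵒᵖ ⥤ Type) ⥤ Dᵒᵖ ⥤ Type) J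
  intro K
  have : IsFiltered (CostructuredArrow F.op K) :=
    IsFiltered.of_equivalence (structuredArrowOpEquivalence F (unop K))
  have := preservesFiniteLimits_colim (CostructuredArrow F.op K)
  exact preservesLimitsOfShape_of_natIso (lanEvaluationIso _ _).symm

end

end StoneDelta

end

/-! ### The main theorem -/

theorem mainTheorem3 (p : ℕ) [Fact p.Prime] (s : PresentationSense) :
    -- `Hom(A, ℤ_p) = Spec (A / p)`, naturally in `A`
    ((∀ A : TD p s, IsHomeomorph (fun f : (u p s).obj A => toSpec A.unop.obj f)) ∧
      ∀ (A B : TD p s) (g : A ⟶ B) (f : (u p s).obj A),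
        toSpec B.unop.obj ((u p s).map g f) =
          PrimeSpectrum.comap (mapModP p (DeltaHom.toRingHom g.unop.hom))
            (toSpec A.unop.obj f)) ∧
    -- `u` is a continuous functor of sites
    IsSite (tdCoverings p s) ∧
    IsContinuousFunctor (tdCoverings p s) lightCoverings (u p s) ∧
    -- the induced morphism of topoi
    ∃ (_ : (u p s).IsContinuous (tdCoverings p s).toGrothendieck (coherentTopology LightProfinite))
      (_ : ∀ F : (TD p s)ᵒᵖ ⥤ Type, (u p s).op.HasPointwiseLeftKanExtension F)
      (ψ_star : LightCondSet.{0} ⥤ TDStk p s) (ψ_pull : TDStk p s ⥤ LightCondSet.{0}),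
      ψ_star = (u p s).sheafPushforwardContinuous Type (tdCoverings p s).toGrothendieck
        (coherentTopology LightProfinite) ∧
      (∀ X : LightCondSet.{0}, (ψ_star.obj X).obj = (u p s).op ⋙ X.obj) ∧
      ψ_pull = sheafToPresheaf _ _ ⋙ (u p s).op.lan ⋙ presheafToSheaf _ _ ∧
      Nonempty (ψ_pull ⊣ ψ_star) ∧ PreservesFiniteLimits ψ_pull := by
  refine ⟨⟨fun A => isHomeomorph_toSpec A.unop.stoneRing, fun A B g f => toSpec_precomp _ f⟩,
    isSite_tdCoverings, isContinuousFunctor_u, isContinuous_u, ?_⟩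
  -- Essential smallness passes to the costructured arrows, so the colimits defining the Kan
  -- extension exist in `Type`.
  have hcolim : ∀ S, HasColimitsOfShape (CostructuredArrow (u p s).op S) Type := fun S =>
    hasColimitsOfShape_of_essentiallySmall.{0} _ _
  refine ⟨fun F S => inferInstance, _, _, rfl, fun _ => rfl, rfl,
    ⟨Functor.sheafPullbackConstruction.sheafAdjunctionContinuous _ _ _ _⟩, ?_⟩
  have := preservesFiniteLimits_lan (u p s)
  have : PreservesFiniteLimits ((u p s).op.lan ⋙
    presheafToSheaf (coherentTopology LightProfinite.{0}) Type) := comp_preservesFiniteLimits _ _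
  exact comp_preservesFiniteLimits _ _
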